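/- Let $p_0=(0,0)$, $p_1=(1,0)$, $p_2=(1/2,\sqrt3/2)$ in $\mathbb R^2$, let $f_j(x)=(x+p_j)/2$ for $j=0,1,2$, and let $K$ be the Sierpiński gasket, i.e. the unique non-empty compact set with $K=f_0(K)\cup f_1(K)\cup f_2(K)$. Put $\alpha=\log 3/\log 2$, $\beta^*=\log 5/\log 2$, and let $\nu$ be the normalized ($\alpha$-dimensional) Hausdorff measure on $K$. For $n\ge1$ let $W_n=\{0,1,2\}^n$, and for $w=w_1\dots w_n\in W_n$ let $f_w=f_{w_1}\circ\dots\circ f_{w_n}$, $K_w=f_w(K)$, $V_w=f_w(\{p_0,p_1,p_2\})$. For $u\in C(K)$ put $$\mathcal E_{\mathrm{loc}}(u,u)=\lim_{n\to\infty}\Big(\frac53\Big)^n\sum_{w\in W_n}\sum_{p,q\in V_w}(u(p)-u(q))^2\in[0,\infty]$$ (the limit exists), and $\mathcal F_{\mathrm{loc}}=\{u\in C(K):\mathcal E_{\mathrm{loc}}(u,u)<\infty\}$. Fix an integer $\gamma\ge1$. For $i,n\ge1$, $w\in W_n$ and $p\in V_w$, say $p=f_w(p_j)$ with $j\in\{0,1,2\}$,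 let $K^{(i)}_{p,n}=K_{w_1\dots w_n j\dots j}$ with $\gamma n i$ letters $j$ after $w$ (this set depends on $w$ as well as on $p$). **Theorem.** Let $(\beta_i)_{i\ge1}\subseteq(\alpha,\beta^*)$ with $\beta_i\uparrow\beta^*$ and $(\delta_i)_{i\ge1}\subseteq(0,1)$ with $\delta_i\uparrow1$. There is an increasing function $\Phi:\mathbb N\to\mathbb N$ with $$(5\cdot2^{-\beta_i}-1)\,\Phi(i)\ge i\quad\text{for all }i\ge1.\tag{1}$$ For every increasing $\Phi:\mathbb N\to\mathbb N$ satisfying (1), define, for $i\ge1$ and $x,y\in K$, $$C_i(x,y)=\sum_{n=1}^{\Phi(i)}2^{-2\alpha n}\sum_{w\in W_n}\ \sum_{\substack{p,q\in V_w\\ p\ne q}}\frac{1}{\nu(K^{(i)}_{p,n})\,\nu(K^{(i)}_{q,n})}1_{K^{(i)}_{p,n}}(x)\,1_{K^{(i)}_{q,n}}(y),\qquad a_i=\delta_iC_i+(1-\delta_i).$$ Then for each $i\ge1$ the function $a_i$ is bounded from above and below on $K\times K$ by positive constants (which may depend on $i$), and for every $u\in\mathcal F_{\mathrm{loc}}$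 $$\lim_{i\to\infty}(5\cdot2^{-\beta_i}-1)\iint_{K\times K\setminus\mathrm{diag}}\frac{a_i(x,y)\,(u(x)-u(y))^2}{|x-y|^{\alpha+\beta_i}}\,\nu(dx)\,\nu(dy)=\mathcal E_{\mathrm{loc}}(u,u).$$ -/

import Mathlib

open MeasureTheory Filter Topology
open scoped ENNReal

noncomputable section

namespace Gasket

/-- The Euclidean plane. -/
abbrev Plane : Type := EuclideanSpace ℝ (Fin 2)

/-- The corners `p₀ = (0,0)`, `p₁ = (1,0)`, `p₂ = (1/2, √3/2)`. -/
def corner : Fin 3 → Plane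
  | 0 => !₂[0, 0]
  | 1 => !₂[1, 0]
  | 2 => !₂[1 / 2, Real.sqrt 3 / 2]

/-- The contractions `f_i(x) = (x + p_i) / 2`. -/
def contr (i : Fin 3) (x : Plane) : Plane := (1 / 2 : ℝ) • (x + corner i)

theorem dist_contr (i : Fin 3) (x y : Plane) :
    dist (contr i x) (contr i y) = dist x y / 2 := by
  unfold contr
  rw [dist_smul₀, dist_add_right]
  norm_num
  ring

theorem continuous_contr (i : Fin 3) : Continuous (contr i) := by
  unfold contr
  fun_prop

/-- `K` is a non-empty compact set with `K = f₀(K) ∪ f₁(K) ∪ f₂(K)`. -/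
def IsGasket (K : Set Plane) : Prop :=
  K.Nonempty ∧ IsCompact K ∧ K = ⋃ i : Fin 3, contr i '' K

theorem IsGasket.subset {A B : Set Plane} (hA : IsGasket A) (hB : IsGasket B) : A ⊆ B := by
  obtain ⟨hA0, hAc, hAe⟩ := hA
  obtain ⟨hB0, hBc, hBe⟩ := hB
  obtain ⟨a, ha, hmax⟩ := hAc.exists_isMaxOn hA0
    (Metric.continuous_infDist_pt B).continuousOn
  have key : Metric.infDist a B ≤ Metric.infDist a B / 2 := by
    have ha' := ha
    rw [hAe] at ha'
    obtain ⟨i, b, hb, rfl⟩ := Set.mem_iUnion.1 ha'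
    obtain ⟨c, hc, hbc⟩ := hBc.exists_infDist_eq_dist hB0 b
    have h1 : contr i c ∈ B := by
      rw [hBe]
      exact Set.mem_iUnion.2 ⟨i, c, hc, rfl⟩
    have h2 : Metric.infDist (contr i b) B ≤ dist (contr i b) (contr i c) :=
      Metric.infDist_le_dist_of_mem h1
    have h3 : Metric.infDist b B ≤ Metric.infDist (contr i b) B := hmax hb
    rw [dist_contr, ← hbc] at h2
    linarith
  intro x hx
  have h0 : Metric.infDist x B ≤ Metric.infDist a B := hmax hx
  have h1 : 0 ≤ Metric.infDist x B := Metric.infDist_nonneg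
  exact (hBc.isClosed.mem_iff_infDist_zero hB0).2 (by linarith)

theorem exists_isGasket : ∃ K : Set Plane, IsGasket K := by
  obtain ⟨M, hM⟩ : ∃ M : ℝ, ∀ i, ‖corner i‖ ≤ M :=
    ⟨∑ i, ‖corner i‖, fun i =>
      Finset.single_le_sum (f := fun i => ‖corner i‖) (fun _ _ => norm_nonneg _)
        (Finset.mem_univ i)⟩
  have hbd : ∀ (k : ℕ) (w : ℕ → Fin 3),
      ‖((1 / 2 : ℝ) ^ (k + 1)) • corner (w k)‖ ≤ (1 / 2 : ℝ) ^ k * M := by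
    intro k w
    have h0 : (0 : ℝ) ≤ (1 / 2) ^ k := by positivity
    have h1 := norm_nonneg (corner (w k))
    rw [norm_smul, Real.norm_of_nonneg (by positivity), pow_succ]
    nlinarith [hM (w k), mul_le_mul_of_nonneg_left (hM (w k)) h0, mul_nonneg h0 h1]
  have hsum : Summable fun k : ℕ => (1 / 2 : ℝ) ^ k * M :=
    (summable_geometric_of_lt_one (by norm_num) (by norm_num)).mul_right M
  let π : (ℕ → Fin 3) → Plane := fun w => ∑' k, ((1 / 2 : ℝ) ^ (k + 1)) • corner (w k)
  have hs : ∀ w : ℕ → Fin 3, Summable fun k => ((1 / 2 : ℝ) ^ (k + 1)) • corner (w k) :=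
    fun w => Summable.of_norm_bounded hsum fun k => hbd k w
  have hcont : Continuous π := by
    refine continuous_tsum (fun k => ?_) hsum hbd
    have hd : Continuous corner := continuous_of_discreteTopology
    have hk : Continuous fun w : ℕ → Fin 3 => w k := continuous_apply k
    have hc : Continuous fun w : ℕ → Fin 3 => corner (w k) := hd.comp hk
    exact hc.const_smul ((1 / 2 : ℝ) ^ (k + 1))
  have hπ : ∀ w : ℕ → Fin 3, π w = contr (w 0) (π fun k => w (k + 1)) := by
    intro w
    change ∑' k, _ = (1 / 2 : ℝ) • (∑' k, _ + _)
    rw [(hs w).tsum_eq_zero_add, smul_add, add_comm, ← (hs fun k => w (k + 1)).tsum_const_smul]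
    congr 1
    · refine tsum_congr fun k => ?_
      rw [smul_smul]
      congr 1
      ring
    · norm_num
  refine ⟨Set.range π, Set.range_nonempty π, isCompact_range hcont, ?_⟩
  ext x
  simp only [Set.mem_range, Set.mem_iUnion, Set.mem_image]
  constructor
  · rintro ⟨w, rfl⟩
    exact ⟨w 0, _, ⟨_, rfl⟩, (hπ w).symm⟩
  · rintro ⟨i, _, ⟨w, rfl⟩, rfl⟩
    let v : ℕ → Fin 3 := fun k => match k with
      | 0 => i
      | k + 1 => w k
    have hv : π v = contr i (π w) := hπ v
    exact ⟨v, hv⟩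

theorem existsUnique_isGasket : ∃! K : Set Plane, IsGasket K := by
  obtain ⟨K, hK⟩ := exists_isGasket
  exact ⟨K, hK, fun L hL => (hL.subset hK).antisymm (hK.subset hL)⟩

/-- The Sierpinski gasket: the unique non-empty compact `K` with `K = ⋃ i, f_i(K)`. -/
def SG : Set Plane := existsUnique_isGasket.choose

theorem isGasket_SG : IsGasket SG := existsUnique_isGasket.choose_spec.1

/-- The Hausdorff dimension `α = log 3 / log 2`. -/
def alphaDim : ℝ := Real.log 3 / Real.log 2

/-- The walk dimension `β* = log 5 / log 2`. -/
def walkDim : ℝ := Real.log 5 / Real.log 2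

/-- The normalized `α`-dimensional Hausdorff measure on the gasket. -/
def nu : Measure Plane := (μH[alphaDim] SG)⁻¹ • (μH[alphaDim]).restrict SG

/-- `f_{w₁} ∘ ⋯ ∘ f_{wₙ}` for a word `w = w₁ … wₙ`. -/
def wordMap : List (Fin 3) → Plane → Plane
  | [] => id
  | i :: w => contr i ∘ wordMap w

/-- The cell `K_w = f_{w₁} ∘ ⋯ ∘ f_{wₙ}(K)`. -/
def cell (w : List (Fin 3)) : Set Plane := wordMap w '' SG

/-- The vertices of `V_w = f_{w₁} ∘ ⋯ ∘ f_{wₙ}({p₀, p₁, p₂})`, listed by the index of the corner.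
They are three distinct points (`vertex_injective`), so a sum over points of `V_w` is a sum over
`j : Fin 3`. -/
def vertex (w : List (Fin 3)) (j : Fin 3) : Plane := wordMap w (corner j)

theorem corner_injective : Function.Injective corner := by
  intro i j h
  have h0 := congrFun (congrArg WithLp.ofLp h) 0
  fin_cases i <;> fin_cases j <;> simp [corner] at h0 ⊢

theorem wordMap_injective (w : List (Fin 3)) : Function.Injective (wordMap w) := by
  induction w with
  | nil => exact Function.injective_id
  | cons i w ih =>
    refine Function.Injective.comp (fun x y h => ?_) ih
    have h1 := dist_contr i x y
    rw [h, dist_self] at h1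
    exact dist_eq_zero.1 (by linarith)

theorem vertex_injective (w : List (Fin 3)) : Function.Injective (vertex w) :=
  (wordMap_injective w).comp corner_injective

/-- The `n`-th approximate energy `(5/3)^n ∑_{w ∈ W_n} ∑_{p,q ∈ V_w} (u(p) - u(q))²`. -/
def levelEnergy (u : Plane → ℝ) (n : ℕ) : ℝ :=
  (5 / 3 : ℝ) ^ n * ∑ w : Fin n → Fin 3, ∑ j : Fin 3, ∑ k : Fin 3,
    (u (vertex (List.ofFn w) j) - u (vertex (List.ofFn w) k)) ^ 2

/-- The local energy `E_loc(u,u) = lim_n levelEnergy u n`, in `[0, ∞]`; the limit exists by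
`tendsto_levelEnergy`. -/
def energyLoc (u : Plane → ℝ) : ℝ≥0∞ :=
  limUnder atTop fun n : ℕ => ENNReal.ofReal (levelEnergy u n)

/-- The domain `F_loc = {u ∈ C(K) : E_loc(u,u) < ∞}`. A function on `K` is represented by a
function on the plane, of which only the values on `K` matter. -/
def domLoc : Set (Plane → ℝ) := {u | ContinuousOn u SG ∧ energyLoc u < ∞}

theorem wordMap_append (v w : List (Fin 3)) (x : Plane) :
    wordMap (v ++ w) x = wordMap v (wordMap w x) := by
  induction v with
  | nil => rfl
  | cons i v ih => simp [wordMap, ih]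

theorem extension_ineq (a b c x y z : ℝ) :
    (a - a) ^ 2 + (a - b) ^ 2 + (a - c) ^ 2 + ((b - a) ^ 2 + (b - b) ^ 2 + (b - c) ^ 2) +
      ((c - a) ^ 2 + (c - b) ^ 2 + (c - c) ^ 2) ≤
    5 / 3 * ((a - a) ^ 2 + (a - x) ^ 2 + (a - y) ^ 2 +
        ((x - a) ^ 2 + (x - x) ^ 2 + (x - y) ^ 2) + ((y - a) ^ 2 + (y - x) ^ 2 + (y - y) ^ 2) +
      ((x - x) ^ 2 + (x - b) ^ 2 + (x - z) ^ 2 +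
        ((b - x) ^ 2 + (b - b) ^ 2 + (b - z) ^ 2) + ((z - x) ^ 2 + (z - b) ^ 2 + (z - z) ^ 2)) +
      ((y - y) ^ 2 + (y - z) ^ 2 + (y - c) ^ 2 +
        ((z - y) ^ 2 + (z - z) ^ 2 + (z - c) ^ 2) +
        ((c - y) ^ 2 + (c - z) ^ 2 + (c - c) ^ 2))) := by
  linarith [sq_nonneg (5 * x - 2 * a - 2 * b - c),
    sq_nonneg (5 * y - 2 * a - 2 * c - b), sq_nonneg (5 * z - 2 * b - 2 * c - a),
    sq_nonneg ((5 * x - 2 * a - 2 * b - c) - (5 * y - 2 * a - 2 * c - b)),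
    sq_nonneg ((5 * x - 2 * a - 2 * b - c) - (5 * z - 2 * b - 2 * c - a)),
    sq_nonneg ((5 * y - 2 * a - 2 * c - b) - (5 * z - 2 * b - 2 * c - a))]

theorem monotone_levelEnergy (u : Plane → ℝ) : Monotone (levelEnergy u) := by
  refine monotone_nat_of_le_succ fun n => ?_
  unfold levelEnergy
  have hself : ∀ j, contr j (corner j) = corner j := fun j => by
    unfold contr
    rw [← two_smul ℝ (corner j), smul_smul]
    norm_num
  have hcomm : ∀ j k, contr j (corner k) = contr k (corner j) := fun j k => by
    unfold contr
    rw [add_comm]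
  have hsplit : ∑ w : Fin (n + 1) → Fin 3, ∑ j : Fin 3, ∑ k : Fin 3,
      (u (vertex (List.ofFn w) j) - u (vertex (List.ofFn w) k)) ^ 2 =
      ∑ w : Fin n → Fin 3, ∑ i : Fin 3, ∑ j : Fin 3, ∑ k : Fin 3,
      (u (wordMap (List.ofFn w) (contr i (corner j))) -
        u (wordMap (List.ofFn w) (contr i (corner k)))) ^ 2 := by
    rw [← (Fin.snocEquiv fun _ : Fin (n + 1) => Fin 3).sum_comp, Fintype.sum_prod_type,
      Finset.sum_comm]
    refine Finset.sum_congr rfl fun w _ => Finset.sum_congr rfl fun i _ => ?_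
    have hw : List.ofFn ((Fin.snocEquiv fun _ : Fin (n + 1) => Fin 3) (i, w)) =
        List.ofFn w ++ [i] := by
      rw [List.ofFn_succ']
      simp [Fin.snocEquiv, List.concat_eq_append]
    rw [hw]
    simp only [vertex, wordMap_append]
    rfl
  rw [hsplit, pow_succ, mul_assoc, Finset.mul_sum (a := (5 / 3 : ℝ))]
  refine mul_le_mul_of_nonneg_left (Finset.sum_le_sum fun w _ => ?_) (by positivity)
  simp only [vertex, Fin.sum_univ_three, hself, hcomm 1 0, hcomm 2 0, hcomm 2 1]
  generalize u (wordMap (List.ofFn w) (corner 0)) = a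
  generalize u (wordMap (List.ofFn w) (corner 1)) = b
  generalize u (wordMap (List.ofFn w) (corner 2)) = c
  generalize u (wordMap (List.ofFn w) (contr 0 (corner 1))) = x
  generalize u (wordMap (List.ofFn w) (contr 0 (corner 2))) = y
  generalize u (wordMap (List.ofFn w) (contr 1 (corner 2))) = z
  exact extension_ineq a b c x y z

theorem tendsto_levelEnergy (u : Plane → ℝ) :
    Tendsto (fun n : ℕ => ENNReal.ofReal (levelEnergy u n)) atTop (𝓝 (energyLoc u)) :=
  tendsto_nhds_limUnder ⟨_, tendsto_atTop_iSup
    fun _ _ h => ENNReal.ofReal_le_ofReal (monotone_levelEnergy u h)⟩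

/-- For `w ∈ W_n` and the vertex `p = f_{w₁} ∘ ⋯ ∘ f_{wₙ}(p_j)` of `V_w`, the small cell
`K^{(i)}_{p,n} = K_{w₁ … wₙ j … j}` at `p`, with `γ n i` letters `j`. -/
def smallCell (γ i : ℕ) {n : ℕ} (w : Fin n → Fin 3) (j : Fin 3) : Set Plane :=
  cell (List.ofFn w ++ List.replicate (γ * n * i) j)

/-- The kernel
`C_i(x,y) = ∑_{n=1}^{N} 2^{-2αn} ∑_{w ∈ W_n} ∑_{p,q ∈ V_w, p ≠ q}
  1_{K^{(i)}_{p,n}}(x) 1_{K^{(i)}_{q,n}}(y) / (ν(K^{(i)}_{p,n}) ν(K^{(i)}_{q,n}))`,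
where `N = Φ(i)` is the cutoff level. -/
def kernelC (γ N i : ℕ) (x y : Plane) : ℝ :=
  ∑ n ∈ Finset.Icc 1 N, (2 : ℝ) ^ (-2 * alphaDim * (n : ℝ)) *
    ∑ w : Fin n → Fin 3, ∑ j : Fin 3, ∑ k ∈ Finset.univ.filter (fun k : Fin 3 => k ≠ j),
      1 / (nu.real (smallCell γ i w j) * nu.real (smallCell γ i w k)) *
        ((smallCell γ i w j).indicator (fun _ => (1 : ℝ)) x *
          (smallCell γ i w k).indicator (fun _ => (1 : ℝ)) y)

/-- The kernel `a_i = δ_i C_i + (1 - δ_i)`, where `N = Φ(i)` and `d = δ_i`. -/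
def kernelA (γ N i : ℕ) (d : ℝ) (x y : Plane) : ℝ :=
  d * kernelC γ N i x y + (1 - d)

/-- `∬_{K × K ∖ diag} a(x,y) (u(x) - u(y))² / |x - y|^{α+β} ν(dx) ν(dy)`, in `[0, ∞]`. -/
def jumpEnergy (a : Plane → Plane → ℝ) (β : ℝ) (u : Plane → ℝ) : ℝ≥0∞ :=
  ∫⁻ z in (SG ×ˢ SG) \ Set.diagonal Plane,
    ENNReal.ofReal (a z.1 z.2 * (u z.1 - u z.2) ^ 2 / dist z.1 z.2 ^ (alphaDim + β)) ∂(nu.prod nu)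

end Gasket

end

open Gasket

namespace Gasket

/-! ### Words and cells -/

/-! Write `ε = 5 * 2 ^ (-β) - 1`, so that `2 ^ β / 5 = (1 + ε)⁻¹`. The kernel splits as `δ C + (1 -
δ)`, and jump energies are additive in the kernel. The part `C` produces the limit, and the constant
part vanishes.

Each summand of `C` averages `(u x - u y)² / |x - y|^(α+β)` over two small cells at vertices `p`,
`q` of a level-`n` cell. There `|x - y|` is nearly `2^(-n)` and `u` is nearly `u p`, `u q`, so the
average is close to `(3 * 2^β)^n (u p - u q)²`. With the weight `2^(-2αn) = 9^(-n)`, and since the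
squared differences at level `n` add up to `(3/5)^n * levelEnergy u n`, level `n` contributes about
`(1+ε)^(-n) * levelEnergy u n`. The errors decay geometrically in `n`, so their sum is bounded and
is killed by the factor `ε` (`exists_jumpEnergy_kernelC_eq`). The weights `ε (1+ε)^(-n)`, `1 ≤ n ≤
Φ`, have total mass `1 - (1+ε)^(-Φ)`. By Bernoulli's inequality and (1) this is at least `1 -
1/(i+1)`, while the mass of any finite range of `n` tends to zero. As `levelEnergy` increases to the
local energy, the weighted sums converge to it (`tendsto_mul_sum_inv_pow_mul`).

For the constant kernel, `ε` times the jump energy is at most a fixed multiple of the local energy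
(`ofReal_mul_jumpEnergy_one_le`), and `1 - δ → 0`. Points at distance about `2^(-n)` lie in
level-`n` cells sharing a vertex, so `(u x - u y)²` is controlled by the energies of `u` on these
cells. Each cell has boundedly many neighbours, and self-similarity turns the sum over scales into a
geometric series with ratio `2^β / 5`, whose sum is of order `1/ε`.

Both parts need the values `ν(K_w) = 3^(-n)`. These follow from scaling once the Hausdorff measure
of the gasket is known to be finite and positive. -/

theorem sum_words_succ {M : Type*} [AddCommMonoid M] (n : ℕ) (F : List (Fin 3) → M) :
    ∑ w : Fin (n + 1) → Fin 3, F (List.ofFn w) =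
      ∑ i : Fin 3, ∑ w : Fin n → Fin 3, F (i :: List.ofFn w) := by
  rw [← (Fin.consEquiv fun _ : Fin (n + 1) => Fin 3).sum_comp, Fintype.sum_prod_type]
  refine Finset.sum_congr rfl fun i _ => Finset.sum_congr rfl fun w _ => ?_
  rw [List.ofFn_succ]
  simp [Fin.consEquiv]

theorem continuous_wordMap (w : List (Fin 3)) : Continuous (wordMap w) := by
  induction w with
  | nil => exact continuous_id
  | cons i w ih => exact (continuous_contr i).comp ih

theorem dist_wordMap (w : List (Fin 3)) (x y : Plane) :
    dist (wordMap w x) (wordMap w y) = (1 / 2) ^ w.length * dist x y := by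
  induction w with
  | nil => simp [wordMap]
  | cons i w ih =>
    simp only [wordMap, Function.comp_apply, dist_contr, ih, List.length_cons, pow_succ]
    ring

theorem contr_corner_self (j : Fin 3) : contr j (corner j) = corner j := by
  unfold contr
  rw [← two_smul ℝ (corner j), smul_smul]
  norm_num

theorem contr_corner_comm (j k : Fin 3) : contr j (corner k) = contr k (corner j) := by
  unfold contr
  rw [add_comm]

theorem wordMap_replicate_corner (m : ℕ) (j : Fin 3) :
    wordMap (List.replicate m j) (corner j) = corner j := by
  induction m with
  | zero => rfl
  | succ m ih => simp [List.replicate_succ, wordMap, ih, contr_corner_self]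

theorem vertex_append_replicate (w : List (Fin 3)) (m : ℕ) (j : Fin 3) :
    vertex (w ++ List.replicate m j) j = vertex w j := by
  simp only [vertex, wordMap_append, wordMap_replicate_corner]

theorem isCompact_SG : IsCompact SG := isGasket_SG.2.1

theorem contr_mem_SG {x : Plane} (i : Fin 3) (hx : x ∈ SG) : contr i x ∈ SG := by
  rw [isGasket_SG.2.2]
  exact Set.mem_iUnion.2 ⟨i, x, hx, rfl⟩

theorem wordMap_mem_SG (w : List (Fin 3)) {x : Plane} (hx : x ∈ SG) : wordMap w x ∈ SG := by
  induction w with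
  | nil => exact hx
  | cons i w ih => exact contr_mem_SG i ih

/-- The corner is the fixed point of `contr j`, which maps a nearest point of the gasket to a point
of the gasket half as far away; so the distance is zero. -/
theorem corner_mem_SG (j : Fin 3) : corner j ∈ SG := by
  have hne := isGasket_SG.1
  obtain ⟨c, hc, hd⟩ := isCompact_SG.exists_infDist_eq_dist hne (corner j)
  have h1 := Metric.infDist_le_dist_of_mem (x := corner j) (contr_mem_SG j hc)
  have h2 := dist_contr j (corner j) c
  rw [contr_corner_self] at h2
  have h3 : (0 : ℝ) ≤ Metric.infDist (corner j) SG := Metric.infDist_nonneg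
  exact (isCompact_SG.isClosed.mem_iff_infDist_zero hne).2 (by linarith)

theorem vertex_mem_SG (w : List (Fin 3)) (j : Fin 3) : vertex w j ∈ SG :=
  wordMap_mem_SG w (corner_mem_SG j)

theorem isCompact_cell (w : List (Fin 3)) : IsCompact (cell w) :=
  isCompact_SG.image (continuous_wordMap w)

theorem measurableSet_cell (w : List (Fin 3)) : MeasurableSet (cell w) :=
  (isCompact_cell w).measurableSet

theorem cell_subset_SG (w : List (Fin 3)) : cell w ⊆ SG := by
  rintro _ ⟨x, hx, rfl⟩
  exact wordMap_mem_SG w hx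

theorem vertex_mem_cell (w : List (Fin 3)) (j : Fin 3) : vertex w j ∈ cell w :=
  ⟨corner j, corner_mem_SG j, rfl⟩

theorem exists_mem_cell {x : Plane} (hx : x ∈ SG) (n : ℕ) :
    ∃ w : Fin n → Fin 3, x ∈ cell (List.ofFn w) := by
  induction n generalizing x with
  | zero => exact ⟨Fin.elim0, x, hx, by simp [wordMap]⟩
  | succ n ih =>
    rw [isGasket_SG.2.2] at hx
    obtain ⟨i, y, hy, rfl⟩ := Set.mem_iUnion.1 hx
    obtain ⟨w, z, hz, rfl⟩ := ih hy
    refine ⟨Fin.cons i w, z, hz, ?_⟩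
    rw [List.ofFn_succ]
    simp [wordMap]

theorem dist_corner {i j : Fin 3} (h : i ≠ j) : dist (corner i) (corner j) = 1 := by
  have h3 : Real.sqrt 3 ^ 2 = 3 := Real.sq_sqrt (by norm_num)
  rw [EuclideanSpace.dist_eq, Real.sqrt_eq_one]
  fin_cases i <;> fin_cases j <;> simp [corner, Fin.sum_univ_two, Real.dist_eq] at h ⊢ <;>
    ring_nf <;> norm_num [h3]

theorem dist_corner_le (i j : Fin 3) : dist (corner i) (corner j) ≤ 1 := by
  rcases eq_or_ne i j with rfl | h
  · simp
  · exact (dist_corner h).le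

/-- Passing through the image of `corner j` under the first contraction, the maximal distance `M`
satisfies `M ≤ M / 2 + 1 / 2`. -/
theorem dist_corner_le_one {x : Plane} (hx : x ∈ SG) (j : Fin 3) : dist x (corner j) ≤ 1 := by
  obtain ⟨a, ha, hmax⟩ := isCompact_SG.exists_isMaxOn isGasket_SG.1
    (f := fun x => dist x (corner j)) (by fun_prop)
  have key : dist a (corner j) ≤ 1 := by
    have ha' := ha
    rw [isGasket_SG.2.2] at ha'
    obtain ⟨i, b, hb, rfl⟩ := Set.mem_iUnion.1 ha'
    have h1 := dist_triangle (contr i b) (contr i (corner j)) (corner j)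
    have h2 := dist_contr j (corner i) (corner j)
    rw [contr_corner_self, contr_corner_comm j i] at h2
    rw [h2, dist_contr] at h1
    have h3 : dist b (corner j) ≤ dist (contr i b) (corner j) := hmax hb
    linarith [dist_corner_le i j]
  exact (hmax hx).trans key

theorem dist_le_two {x y : Plane} (hx : x ∈ SG) (hy : y ∈ SG) : dist x y ≤ 2 := by
  linarith [dist_triangle_right x y (corner 0), dist_corner_le_one hx 0, dist_corner_le_one hy 0]

theorem dist_vertex_le {w : List (Fin 3)} {x : Plane} (hx : x ∈ cell w) (j : Fin 3) :
    dist x (vertex w j) ≤ (1 / 2) ^ w.length := by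
  obtain ⟨y, hy, rfl⟩ := hx
  rw [vertex, dist_wordMap]
  exact mul_le_of_le_one_right (by positivity) (dist_corner_le_one hy j)

/-! ### Self-similarity of the energy -/

theorem levelEnergy_nonneg (u : Plane → ℝ) (n : ℕ) : 0 ≤ levelEnergy u n := by
  unfold levelEnergy
  positivity

/-- Here the first letter is split off, which gives self-similarity; monotonicity in `n` comes from
splitting off the last one. -/
theorem levelEnergy_succ (u : Plane → ℝ) (n : ℕ) :
    levelEnergy u (n + 1) = 5 / 3 * ∑ i, levelEnergy (u ∘ contr i) n := by
  unfold levelEnergy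
  rw [sum_words_succ n (fun w => ∑ j : Fin 3, ∑ k : Fin 3, (u (vertex w j) - u (vertex w k)) ^ 2),
    ← Finset.mul_sum, pow_succ]
  simp only [vertex, wordMap, Function.comp_apply]
  ring

theorem energyLoc_eq_sum_contr (u : Plane → ℝ) :
    energyLoc u = ENNReal.ofReal (5 / 3) * ∑ i, energyLoc (u ∘ contr i) := by
  have h1 := (tendsto_levelEnergy u).comp (tendsto_add_atTop_nat 1)
  have h2 : Tendsto (fun n : ℕ => ENNReal.ofReal (5 / 3) *
      ∑ i, ENNReal.ofReal (levelEnergy (u ∘ contr i) n)) atTop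
      (𝓝 (ENNReal.ofReal (5 / 3) * ∑ i, energyLoc (u ∘ contr i))) :=
    ENNReal.Tendsto.const_mul (tendsto_finsetSum _ fun i _ => tendsto_levelEnergy _)
      (Or.inr ENNReal.ofReal_ne_top)
  refine tendsto_nhds_unique h1 (h2.congr fun n => ?_)
  simp only [Function.comp_apply]
  rw [levelEnergy_succ, ENNReal.ofReal_mul (by norm_num),
    ENNReal.ofReal_sum_of_nonneg fun i _ => levelEnergy_nonneg _ _]

theorem sum_energyLoc_contr (u : Plane → ℝ) :
    ∑ i, energyLoc (u ∘ contr i) = ENNReal.ofReal (3 / 5) * energyLoc u := by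
  rw [energyLoc_eq_sum_contr u, ← mul_assoc, ← ENNReal.ofReal_mul (by norm_num)]
  norm_num

/-- Iterated self-similarity. The factor `(3/5)^n` is the gain that makes the sum over scales for
the constant kernel converge. -/
theorem sum_energyLoc_wordMap (u : Plane → ℝ) (n : ℕ) :
    ∑ w : Fin n → Fin 3, energyLoc (u ∘ wordMap (List.ofFn w)) =
      ENNReal.ofReal ((3 / 5) ^ n) * energyLoc u := by
  induction n generalizing u with
  | zero => simp [wordMap]
  | succ n ih =>
    rw [sum_words_succ n (fun w => energyLoc (u ∘ wordMap w))]
    have h : ∀ i : Fin 3, ∑ w : Fin n → Fin 3, energyLoc (u ∘ wordMap (i :: List.ofFn w)) =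
        ENNReal.ofReal ((3 / 5) ^ n) * energyLoc (u ∘ contr i) := fun i => ih (u ∘ contr i)
    simp only [h]
    rw [← Finset.mul_sum, sum_energyLoc_contr, ← mul_assoc, ← ENNReal.ofReal_mul (by positivity),
      pow_succ]

theorem levelEnergy_le_energyLoc (u : Plane → ℝ) (n : ℕ) :
    ENNReal.ofReal (levelEnergy u n) ≤ energyLoc u :=
  Monotone.ge_of_tendsto (f := fun n => ENNReal.ofReal (levelEnergy u n))
    (fun _ _ h => ENNReal.ofReal_le_ofReal (monotone_levelEnergy u h)) (tendsto_levelEnergy u) n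

theorem levelEnergy_congr {u v : Plane → ℝ} (h : Set.EqOn u v SG) (n : ℕ) :
    levelEnergy u n = levelEnergy v n := by
  unfold levelEnergy
  simp only [h (vertex_mem_SG _ _)]

theorem energyLoc_congr {u v : Plane → ℝ} (h : Set.EqOn u v SG) : energyLoc u = energyLoc v := by
  unfold energyLoc
  simp only [levelEnergy_congr h]

/-! ### Oscillation estimates -/

/-- Self-similarity gives the factor `3/5` for the energy. Weakening it to `16/25 = (4/5)²` keeps
the decay of oscillations rational, and is affordable because the small cells are very deep. -/
theorem levelEnergy_comp_contr_le {u : Plane → ℝ} {S : ℝ}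
    (h : ∀ m, levelEnergy u m ≤ S ^ 2) (i : Fin 3) (m : ℕ) :
    levelEnergy (u ∘ contr i) m ≤ (4 / 5 * S) ^ 2 := by
  have h1 := levelEnergy_succ u m
  have h2 := Finset.single_le_sum (f := fun i => levelEnergy (u ∘ contr i) m)
    (fun i _ => levelEnergy_nonneg _ _) (Finset.mem_univ i)
  nlinarith [h (m + 1), sq_nonneg S]

theorem levelEnergy_comp_wordMap_le {u : Plane → ℝ} {S : ℝ}
    (h : ∀ m, levelEnergy u m ≤ S ^ 2) (w : List (Fin 3)) (m : ℕ) :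
    levelEnergy (u ∘ wordMap w) m ≤ ((4 / 5) ^ w.length * S) ^ 2 := by
  induction w generalizing u S with
  | nil => simpa [wordMap] using h m
  | cons i w ih =>
    have := ih (levelEnergy_comp_contr_le h i)
    rw [List.length_cons, pow_succ (4 / 5 : ℝ), mul_assoc]
    exact this

theorem sq_sub_corner_le_levelEnergy_zero (u : Plane → ℝ) (i j : Fin 3) :
    (u (corner i) - u (corner j)) ^ 2 ≤ levelEnergy u 0 := by
  unfold levelEnergy
  simp only [pow_zero, one_mul, Finset.univ_unique, Finset.sum_singleton, List.ofFn_zero, vertex,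
    wordMap, id]
  refine le_trans ?_ (Finset.single_le_sum (f := fun j => ∑ k,
    (u (corner j) - u (corner k)) ^ 2) (fun _ _ => by positivity) (Finset.mem_univ i))
  exact Finset.single_le_sum (f := fun k => (u (corner i) - u (corner k)) ^ 2)
    (fun _ _ => sq_nonneg _) (Finset.mem_univ j)

/-- Chaining along the word: inside the cell of the first letter `i` one reaches `contr i (corner j)
= contr j (corner i)`, then one edge of the `j`-cell leads to `corner j`. The constant `4` solves `c
= (4/5) c + 4/5`. -/
theorem abs_sub_vertex_corner_le {u : Plane → ℝ} {S : ℝ} (hS : 0 ≤ S)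
    (h : ∀ m, levelEnergy u m ≤ S ^ 2) (w : List (Fin 3)) (j : Fin 3) :
    |u (vertex w j) - u (corner j)| ≤ 4 * S := by
  induction w generalizing u S with
  | nil => simpa [vertex, wordMap] using hS
  | cons i w ih =>
    have h1 := ih (by positivity) (levelEnergy_comp_contr_le h i)
    have h2 : |u (contr j (corner i)) - u (contr j (corner j))| ≤ 4 / 5 * S :=
      abs_le_of_sq_le_sq ((sq_sub_corner_le_levelEnergy_zero (u ∘ contr j) i j).trans
        (levelEnergy_comp_contr_le h j 0)) (by positivity)
    rw [contr_corner_self, contr_corner_comm] at h2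
    have h3 := abs_sub_le (u (contr i (vertex w j))) (u (contr i (corner j))) (u (corner j))
    change |u (contr i (vertex w j)) - u (contr i (corner j))| ≤ _ at h1
    change |u (contr i (vertex w j)) - u (corner j)| ≤ _
    linarith

theorem exists_tendsto_vertex {x : Plane} (hx : x ∈ SG) (j : Fin 3) :
    ∃ v : ℕ → List (Fin 3), Tendsto (fun n => vertex (v n) j) atTop (𝓝 x) := by
  choose w hw using fun n => exists_mem_cell hx n
  refine ⟨fun n => List.ofFn (w n), tendsto_iff_dist_tendsto_zero.2 ?_⟩
  refine squeeze_zero (fun _ => dist_nonneg) (fun n => ?_)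
    (tendsto_pow_atTop_nhds_zero_of_lt_one (r := (1 / 2 : ℝ)) (by norm_num) (by norm_num))
  rw [dist_comm]
  simpa using dist_vertex_le (hw n) j

/-- The vertex bound passes to all points by continuity, since the vertices with a fixed index `j`
are dense in the gasket. -/
theorem abs_sub_corner_le {u : Plane → ℝ} (hu : Continuous u) {S : ℝ} (hS : 0 ≤ S)
    (h : ∀ m, levelEnergy u m ≤ S ^ 2) {x : Plane} (hx : x ∈ SG) (j : Fin 3) :
    |u x - u (corner j)| ≤ 4 * S := by
  obtain ⟨v, hv⟩ := exists_tendsto_vertex hx j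
  exact le_of_tendsto (((hu.tendsto x).comp hv).sub_const (u (corner j))).abs
    (Eventually.of_forall fun n => abs_sub_vertex_corner_le hS h (v n) j)

theorem abs_sub_vertex_le {u : Plane → ℝ} (hu : Continuous u) {S : ℝ} (hS : 0 ≤ S)
    (h : ∀ m, levelEnergy u m ≤ S ^ 2) {w : List (Fin 3)} {x : Plane} (hx : x ∈ cell w)
    (j : Fin 3) : |u x - u (vertex w j)| ≤ 4 * ((4 / 5) ^ w.length * S) := by
  obtain ⟨y, hy, rfl⟩ := hx
  exact abs_sub_corner_le (hu.comp (continuous_wordMap w)) (by positivity)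
    (levelEnergy_comp_wordMap_le h w) hy j

theorem levelEnergy_le_toReal {u : Plane → ℝ} (h : energyLoc u ≠ ∞) (m : ℕ) :
    levelEnergy u m ≤ (energyLoc u).toReal :=
  (ENNReal.ofReal_le_iff_le_toReal h).1 (levelEnergy_le_energyLoc u m)

theorem ofReal_sq_sub_vertex_le {u : Plane → ℝ} (hu : Continuous u) {w : List (Fin 3)} {x : Plane}
    (hx : x ∈ cell w) (j : Fin 3) :
    ENNReal.ofReal ((u x - u (vertex w j)) ^ 2) ≤ 16 * energyLoc (u ∘ wordMap w) := by
  rcases eq_or_ne (energyLoc (u ∘ wordMap w)) ∞ with h | h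
  · simp [h]
  obtain ⟨y, hy, rfl⟩ := hx
  have hm := levelEnergy_le_toReal h
  set E := (energyLoc (u ∘ wordMap w)).toReal with hE
  have hE0 : 0 ≤ E := ENNReal.toReal_nonneg
  have h1 := abs_sub_corner_le (hu.comp (continuous_wordMap w)) (Real.sqrt_nonneg E)
    (fun m => (hm m).trans_eq (Real.sq_sqrt hE0).symm) hy j
  have h2 : (u (wordMap w y) - u (vertex w j)) ^ 2 ≤ 16 * E := by
    have h4 := pow_le_pow_left₀ (abs_nonneg _) h1 2
    rw [sq_abs, mul_pow, Real.sq_sqrt hE0] at h4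
    change (u (wordMap w y) - u (vertex w j)) ^ 2 ≤ _ at h4
    linarith
  calc _ ≤ ENNReal.ofReal (16 * E) := ENNReal.ofReal_le_ofReal h2
    _ = _ := by
      rw [ENNReal.ofReal_mul (by norm_num), hE, ENNReal.ofReal_toReal h]
      norm_num

/-! ### Barycentric coordinates and neighbouring cells -/

/-- The barycentric coordinates with respect to the three corners. -/
noncomputable def bary : Fin 3 → Plane → ℝ
  | 0, x => 1 - x 0 - x 1 / Real.sqrt 3
  | 1, x => x 0 - x 1 / Real.sqrt 3
  | 2, x => 2 * x 1 / Real.sqrt 3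

theorem bary_corner (c i : Fin 3) : bary c (corner i) = if i = c then 1 else 0 := by
  have h3 : Real.sqrt 3 ≠ 0 := by positivity
  fin_cases c <;> fin_cases i <;> simp [bary, corner] <;> field_simp <;> norm_num

theorem bary_contr (c i : Fin 3) (x : Plane) :
    bary c (contr i x) = (bary c x + if i = c then 1 else 0) / 2 := by
  rw [← bary_corner]
  fin_cases c <;> simp [bary, contr] <;> ring

theorem bary_ext {x y : Plane} (h : ∀ c, bary c x = bary c y) : x = y := by
  have h3 : Real.sqrt 3 ≠ 0 := by positivity
  have h1 := h 1
  have h2 := h 2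
  simp only [bary] at h1 h2
  have e1 : x 1 = y 1 := by field_simp at h2; linarith
  have e0 : x 0 = y 0 := by rw [e1] at h1; linarith
  ext i
  fin_cases i
  · exact e0
  · exact e1

theorem continuous_bary (c : Fin 3) : Continuous (bary c) := by
  fin_cases c
  · change Continuous fun x : Plane => 1 - x 0 - x 1 / Real.sqrt 3
    fun_prop
  · change Continuous fun x : Plane => x 0 - x 1 / Real.sqrt 3
    fun_prop
  · change Continuous fun x : Plane => 2 * x 1 / Real.sqrt 3
    fun_prop

theorem abs_apply_sub_le_dist (x y : Plane) (i : Fin 2) : |x i - y i| ≤ dist x y := by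
  rw [dist_eq_norm]
  exact PiLp.norm_apply_le (x - y) i

theorem abs_bary_sub_le (c : Fin 3) (x y : Plane) : |bary c x - bary c y| ≤ 2 * dist x y := by
  have h0 := abs_le.1 (abs_apply_sub_le_dist x y 0)
  have h3 : (1 : ℝ) ≤ Real.sqrt 3 := Real.one_le_sqrt.2 (by norm_num)
  have h1 : |x 1 / Real.sqrt 3 - y 1 / Real.sqrt 3| ≤ dist x y := by
    rw [← sub_div, abs_div, abs_of_nonneg (Real.sqrt_nonneg 3)]
    exact (div_le_self (abs_nonneg _) h3).trans (abs_apply_sub_le_dist x y 1)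
  have h1 := abs_le.1 h1
  rw [abs_le]
  fin_cases c <;> simp only [bary, mul_div_assoc] <;> constructor <;> linarith

/-- At a minimum point, the preimage under a contraction has coordinate `b` with `b / 2 ≤ b` or `(b
+ 1) / 2 ≤ b`; either way `b ≥ 0`, and so is the minimum. -/
theorem bary_nonneg (c : Fin 3) {x : Plane} (hx : x ∈ SG) : 0 ≤ bary c x := by
  obtain ⟨a, ha, hmin⟩ := isCompact_SG.exists_isMinOn isGasket_SG.1 (continuous_bary c).continuousOn
  refine le_trans ?_ (hmin hx)
  rw [isGasket_SG.2.2] at ha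
  obtain ⟨i, b, hb, rfl⟩ := Set.mem_iUnion.1 ha
  have h : bary c (contr i b) ≤ bary c b := hmin hb
  rw [bary_contr] at h ⊢
  split_ifs at h ⊢ <;> linarith

theorem sum_bary (x : Plane) : ∑ c, bary c x = 1 := by
  simp only [Fin.sum_univ_three, bary]
  ring

theorem bary_le_one (c : Fin 3) {x : Plane} (hx : x ∈ SG) : bary c x ≤ 1 := by
  rw [← sum_bary x]
  exact Finset.single_le_sum (f := fun c => bary c x) (fun c _ => bary_nonneg c hx)
    (Finset.mem_univ c)

/-- The integers `m_c` such that `f_w` has barycentric coordinates `2^{-|w|} (m_c + ·)`. -/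
def cellIndex (c : Fin 3) : List (Fin 3) → ℤ
  | [] => 0
  | i :: w => (if i = c then 2 ^ w.length else 0) + cellIndex c w

theorem bary_wordMap (c : Fin 3) (w : List (Fin 3)) (x : Plane) :
    bary c (wordMap w x) = (1 / 2) ^ w.length * (cellIndex c w + bary c x) := by
  induction w with
  | nil => simp [wordMap, cellIndex]
  | cons i w ih =>
    have h : ((1 / 2 : ℝ)) ^ w.length * 2 ^ w.length = 1 := by rw [← mul_pow]; norm_num
    simp only [wordMap, Function.comp_apply, bary_contr, ih, cellIndex, List.length_cons, pow_succ]
    split_ifs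
    · push_cast
      linear_combination (-1 / 2) * h
    · push_cast
      ring

theorem cellIndex_nonneg (c : Fin 3) (w : List (Fin 3)) : 0 ≤ cellIndex c w := by
  induction w with
  | nil => simp [cellIndex]
  | cons i w ih =>
    rw [cellIndex]
    split_ifs <;> positivity

theorem cellIndex_lt (c : Fin 3) (w : List (Fin 3)) : cellIndex c w < 2 ^ w.length := by
  induction w with
  | nil => simp [cellIndex]
  | cons i w ih =>
    rw [cellIndex, List.length_cons, pow_succ]
    have : (0 : ℤ) < 2 ^ w.length := by positivity
    split_ifs <;> linarith

theorem sum_cellIndex (w : List (Fin 3)) : ∑ c, cellIndex c w = 2 ^ w.length - 1 := by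
  induction w with
  | nil => simp [cellIndex]
  | cons i w ih =>
    simp only [cellIndex, Finset.sum_add_distrib, ih, List.length_cons, pow_succ]
    simp
    ring

/-- The indices are binary expansions: the first letter is the only coordinate whose index reaches
`2 ^ w.length`, with `w` the remaining word. -/
theorem eq_of_cellIndex_eq {v w : List (Fin 3)} (hl : v.length = w.length)
    (h : ∀ c, cellIndex c v = cellIndex c w) : v = w := by
  induction v generalizing w with
  | nil => exact (List.length_eq_zero_iff.1 hl.symm).symm
  | cons i v ih =>
    match w, hl with
    | k :: w, hl =>
      have hl' : v.length = w.length := by simpa using hl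
      have hik : i = k := by
        have hi := h i
        simp only [cellIndex, if_true] at hi
        by_contra hne
        rw [if_neg (Ne.symm hne), hl'] at hi
        linarith [cellIndex_nonneg i v, cellIndex_lt i w]
      subst hik
      rw [ih hl' fun c => by simpa [cellIndex, hl'] using h c]

/-- Two words are neighbours if their cell indices differ by at most one; for words of the same
length this means that the cells share a vertex. -/
def Near (v w : List (Fin 3)) : Prop := ∀ c, |cellIndex c v - cellIndex c w| ≤ 1

theorem Near.symm {v w : List (Fin 3)} (h : Near v w) : Near w v := fun c => by
  rw [abs_sub_comm]
  exact h c

/-- Barycentric coordinates are 2-Lipschitz and lie in `[0, 1]` on the gasket, so the integer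
indices differ by strictly less than two. -/
theorem near_of_dist_lt {v w : List (Fin 3)} (hl : v.length = w.length) {x y : Plane}
    (hx : x ∈ cell v) (hy : y ∈ cell w) (hd : dist x y < (1 / 2) ^ (v.length + 1)) : Near v w := by
  obtain ⟨x, hx, rfl⟩ := hx
  obtain ⟨y, hy, rfl⟩ := hy
  intro c
  have h := abs_bary_sub_le c (wordMap v x) (wordMap w y)
  rw [bary_wordMap, bary_wordMap, ← hl, ← mul_sub, abs_mul, abs_of_nonneg (by positivity)] at h
  have h1 : (1 / 2 : ℝ) ^ v.length *
      |(cellIndex c v + bary c x) - (cellIndex c w + bary c y)| < (1 / 2) ^ v.length * 1 := by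
    refine h.trans_lt ?_
    rw [pow_succ] at hd
    linarith
  have h2 := abs_lt.1 (lt_of_mul_lt_mul_left h1 (by positivity))
  have := bary_nonneg c hx
  have := bary_nonneg c hy
  have := bary_le_one c hx
  have := bary_le_one c hy
  have h3 : ((cellIndex c v - cellIndex c w : ℤ) : ℝ) < (2 : ℤ) := by push_cast; linarith [h2.2]
  have h4 : ((-2 : ℤ) : ℝ) < ((cellIndex c v - cellIndex c w : ℤ) : ℝ) := by
    push_cast; linarith [h2.1]
  have h3 := Int.cast_lt.1 h3
  have h4 := Int.cast_lt.1 h4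
  rw [abs_le]
  omega

theorem Near.exists_vertex_eq {v w : List (Fin 3)} (h : Near v w) (hl : v.length = w.length) :
    ∃ j k, vertex v j = vertex w k := by
  have key : ∃ j k : Fin 3, ∀ c, cellIndex c v + (if j = c then 1 else 0) =
      cellIndex c w + (if k = c then 1 else 0) := by
    have hs : ∑ c, cellIndex c v = ∑ c, cellIndex c w := by rw [sum_cellIndex, sum_cellIndex, hl]
    simp only [Fin.sum_univ_three] at hs
    have h0 := abs_le.1 (h 0)
    have h1 := abs_le.1 (h 1)
    have h2 := abs_le.1 (h 2)
    have e : ∀ a b c d : ℤ, a + b = c + d ↔ a - c = d - b := fun a b c d => by omega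
    simp only [e, Fin.forall_fin_succ]
    generalize hz0 : cellIndex 0 v - cellIndex 0 w = z0 at *
    generalize hz1 : cellIndex 1 v - cellIndex 1 w = z1 at *
    have hz2 : cellIndex 2 v - cellIndex 2 w = -z0 - z1 := by omega
    have h2' : -1 ≤ -z0 - z1 ∧ -z0 - z1 ≤ 1 := by omega
    obtain ⟨a0, b0⟩ := h0
    obtain ⟨a1, b1⟩ := h1
    -- Index differences lie in `{-1, 0, 1}` and sum to zero. Of the nine choices of the first two,
    -- `±(1, 1)` are impossible; the other seven are zero or a difference of two unit vectors, which
    -- names the corners to match.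
    interval_cases z0 <;> interval_cases z1 <;> first
      | (exfalso; omega)
      | (refine ⟨0, 0, ?_⟩; simp [hz1, hz2]; done)
      | (refine ⟨0, 1, ?_⟩; simp [hz1, hz2]; done)
      | (refine ⟨0, 2, ?_⟩; simp [hz1, hz2]; done)
      | (refine ⟨1, 0, ?_⟩; simp [hz1, hz2]; done)
      | (refine ⟨1, 2, ?_⟩; simp [hz1, hz2]; done)
      | (refine ⟨2, 0, ?_⟩; simp [hz1, hz2]; done)
      | (refine ⟨2, 1, ?_⟩; simp [hz1, hz2])
  obtain ⟨j, k, hjk⟩ := key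
  refine ⟨j, k, bary_ext fun c => ?_⟩
  have := congrArg (Int.cast : ℤ → ℝ) (hjk c)
  push_cast at this
  rw [vertex, vertex, bary_wordMap, bary_wordMap, bary_corner, bary_corner, hl, this]

-- Two of the index differences have three values each, and the third index is determined by
-- `sum_cellIndex`.
open Classical in
theorem card_near_le {n : ℕ} (v : List (Fin 3)) :
    (Finset.univ.filter fun w : Fin n → Fin 3 => Near v (List.ofFn w)).card ≤ 9 := by
  have hmaps : Set.MapsTo (fun w : Fin n → Fin 3 =>
      (cellIndex 1 v - cellIndex 1 (List.ofFn w), cellIndex 2 v - cellIndex 2 (List.ofFn w)))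
      (Finset.univ.filter fun w : Fin n → Fin 3 => Near v (List.ofFn w))
      (Finset.Icc (-1 : ℤ) 1 ×ˢ Finset.Icc (-1 : ℤ) 1 : Finset (ℤ × ℤ)) := by
    intro w hw
    have hw : Near v (List.ofFn w) := by simpa using hw
    rw [Finset.mem_coe, Finset.mem_product, Finset.mem_Icc, Finset.mem_Icc]
    exact ⟨abs_le.1 (hw 1), abs_le.1 (hw 2)⟩
  refine (Finset.card_le_card_of_injOn _ hmaps ?_).trans (by decide)
  intro w _ w' _ h
  simp only [Prod.mk.injEq, sub_right_inj] at h
  refine List.ofFn_injective (eq_of_cellIndex_eq (by simp) fun c => ?_)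
  have h1 := sum_cellIndex (List.ofFn w)
  have h2 := sum_cellIndex (List.ofFn w')
  simp only [Fin.sum_univ_three, List.length_ofFn] at h1 h2
  fin_cases c
  · change cellIndex 0 _ = cellIndex 0 _
    omega
  · exact h.1
  · exact h.2

/-! ### The Hausdorff measure of the gasket and its cells -/

theorem two_rpow_alphaDim : (2 : ℝ) ^ alphaDim = 3 := by
  rw [alphaDim, Real.rpow_def_of_pos (by norm_num),
    mul_div_cancel₀ _ (Real.log_pos (by norm_num)).ne', Real.exp_log (by norm_num)]

theorem two_rpow_walkDim : (2 : ℝ) ^ walkDim = 5 := by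
  rw [walkDim, Real.rpow_def_of_pos (by norm_num),
    mul_div_cancel₀ _ (Real.log_pos (by norm_num)).ne', Real.exp_log (by norm_num)]

theorem alphaDim_pos : 0 < alphaDim :=
  div_pos (Real.log_pos (by norm_num)) (Real.log_pos (by norm_num))

theorem ofReal_half_pow_rpow_alphaDim (n : ℕ) :
    ENNReal.ofReal ((1 / 2) ^ n) ^ alphaDim = (3 : ℝ≥0∞)⁻¹ ^ n := by
  have h : (1 / 2 : ℝ) ^ alphaDim = 3⁻¹ := by
    rw [Real.div_rpow (by norm_num) (by norm_num), two_rpow_alphaDim, Real.one_rpow, one_div]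
  rw [ENNReal.ofReal_rpow_of_pos (by positivity), ← Real.rpow_natCast, ← Real.rpow_mul (by norm_num),
    mul_comm, Real.rpow_mul (by norm_num), h, Real.rpow_natCast, ENNReal.ofReal_pow (by norm_num),
    ENNReal.ofReal_inv_of_pos (by norm_num)]
  norm_num

open scoped Pointwise in
theorem hausdorffMeasure_contr_image (i : Fin 3) (S : Set Plane) :
    μH[alphaDim] (contr i '' S) = 3⁻¹ * μH[alphaDim] S := by
  have h : contr i '' S = (1 / 2 : ℝ) • ((fun x => x + corner i) '' S) := by
    rw [← Set.image_smul, Set.image_image]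
    rfl
  rw [h, Measure.hausdorffMeasure_smul₀ alphaDim_pos.le (by norm_num),
    (isometry_add_right (corner i)).hausdorffMeasure_image (Or.inl alphaDim_pos.le)]
  have h2 := ofReal_half_pow_rpow_alphaDim 1
  rw [pow_one, pow_one] at h2
  rw [← h2, ENNReal.smul_def, smul_eq_mul, ENNReal.coe_rpow_of_nonneg _ alphaDim_pos.le]
  congr 2
  rw [ENNReal.ofReal, ENNReal.coe_inj]
  ext
  simp

theorem hausdorffMeasure_cell (w : List (Fin 3)) :
    μH[alphaDim] (cell w) = 3⁻¹ ^ w.length * μH[alphaDim] SG := by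
  induction w with
  | nil => simp [cell, wordMap]
  | cons i w ih =>
    have h : cell (i :: w) = contr i '' cell w := by
      simp only [cell, wordMap, Set.image_comp]
    rw [h, hausdorffMeasure_contr_image, ih, List.length_cons, pow_succ']
    ring

theorem ediam_cell_le (w : List (Fin 3)) :
    Metric.ediam (cell w) ≤ ENNReal.ofReal (2 * (1 / 2) ^ w.length) := by
  refine Metric.ediam_le fun x hx y hy => ?_
  obtain ⟨x, hx, rfl⟩ := hx
  obtain ⟨y, hy, rfl⟩ := hy
  rw [edist_dist, dist_wordMap, mul_comm]
  exact ENNReal.ofReal_le_ofReal (mul_le_mul_of_nonneg_right (dist_le_two hx hy) (by positivity))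

/-- The `3^n` cells of level `n` have diameter at most `2 * 2^(-n)`, so their `α`-th powers add up
to at most `2^α = 3`. -/
theorem hausdorffMeasure_SG_ne_top : μH[alphaDim] SG ≠ ∞ := by
  have h := Measure.hausdorffMeasure_le_liminf_sum (l := atTop) (ι := fun n : ℕ => (Fin n → Fin 3))
    alphaDim SG (fun n => ENNReal.ofReal (2 * (1 / 2) ^ n)) ?_ (fun n w => cell (List.ofFn w)) ?_ ?_
  · refine ne_top_of_le_ne_top (b := 3) (by norm_num) (h.trans ?_)
    refine (liminf_le_liminf (Eventually.of_forall fun n => ?_)).trans_eq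
      (liminf_const (f := (atTop : Filter ℕ)) (3 : ℝ≥0∞))
    calc ∑ w : Fin n → Fin 3, Metric.ediam (cell (List.ofFn w)) ^ alphaDim
        ≤ ∑ w : Fin n → Fin 3, 3 * 3⁻¹ ^ n := by
          refine Finset.sum_le_sum fun w _ => ?_
          refine (ENNReal.rpow_le_rpow (ediam_cell_le _) alphaDim_pos.le).trans_eq ?_
          rw [ENNReal.ofReal_mul (by norm_num), ENNReal.mul_rpow_of_nonneg _ _ alphaDim_pos.le,
            ofReal_half_pow_rpow_alphaDim, List.length_ofFn,
            ENNReal.ofReal_rpow_of_pos (by norm_num), two_rpow_alphaDim]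
          norm_num
      _ = 3 := by
          rw [Finset.sum_const, Finset.card_univ, Fintype.card_fun, Fintype.card_fin,
            Fintype.card_fin, nsmul_eq_mul]
          push_cast
          rw [mul_left_comm, ← mul_pow, ENNReal.mul_inv_cancel (by norm_num) (by norm_num)]
          simp
  · have := (tendsto_pow_atTop_nhds_zero_of_lt_one (r := (1 / 2 : ℝ))
      (by norm_num) (by norm_num)).const_mul 2
    simpa using ENNReal.tendsto_ofReal this
  · exact Eventually.of_forall fun n w => by simpa using ediam_cell_le (List.ofFn w)
  · refine Eventually.of_forall fun n x hx => ?_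
    obtain ⟨w, hw⟩ := exists_mem_cell hx n
    exact Set.mem_iUnion.2 ⟨w, hw⟩

/-- The point of the gasket with the given address. -/
noncomputable def coding (w : ℕ → Fin 3) : Plane := ∑' k, ((1 / 2 : ℝ) ^ (k + 1)) • corner (w k)

theorem norm_corner_le (j : Fin 3) : ‖corner j‖ ≤ 1 := by
  have h := dist_corner_le j 0
  have h0 : corner 0 = 0 := by
    ext i
    fin_cases i <;> simp [corner]
  rwa [h0, dist_zero_right] at h

theorem norm_coding_term_le (k : ℕ) (w : ℕ → Fin 3) :
    ‖((1 / 2 : ℝ) ^ (k + 1)) • corner (w k)‖ ≤ (1 / 2 : ℝ) ^ k := by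
  rw [norm_smul, Real.norm_of_nonneg (by positivity), pow_succ]
  have : (0 : ℝ) ≤ (1 / 2) ^ k := by positivity
  nlinarith [norm_corner_le (w k), mul_le_mul_of_nonneg_left (norm_corner_le (w k)) this]

theorem summable_half_pow : Summable fun k : ℕ => (1 / 2 : ℝ) ^ k :=
  summable_geometric_of_lt_one (by norm_num) (by norm_num)

theorem continuous_coding : Continuous coding := by
  refine continuous_tsum (fun k => ?_) summable_half_pow norm_coding_term_le
  have hd : Continuous corner := continuous_of_discreteTopology
  have hk : Continuous fun w : ℕ → Fin 3 => w k := continuous_apply k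
  have hc : Continuous fun w : ℕ → Fin 3 => corner (w k) := hd.comp hk
  exact hc.const_smul ((1 / 2 : ℝ) ^ (k + 1))

theorem coding_eq_contr (w : ℕ → Fin 3) :
    coding w = contr (w 0) (coding fun k => w (k + 1)) := by
  have hs : ∀ w : ℕ → Fin 3, Summable fun k => ((1 / 2 : ℝ) ^ (k + 1)) • corner (w k) :=
    fun w => Summable.of_norm_bounded summable_half_pow fun k => norm_coding_term_le k w
  change ∑' k, _ = (1 / 2 : ℝ) • (∑' k, _ + _)
  rw [(hs w).tsum_eq_zero_add, smul_add, add_comm, ← (hs fun k => w (k + 1)).tsum_const_smul]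
  congr 1
  · refine tsum_congr fun k => ?_
    rw [smul_smul]
    congr 1
    ring
  · norm_num

theorem range_coding : Set.range coding = SG := by
  have h : IsGasket (Set.range coding) := by
    refine ⟨Set.range_nonempty _, isCompact_range continuous_coding, ?_⟩
    ext x
    simp only [Set.mem_range, Set.mem_iUnion, Set.mem_image]
    constructor
    · rintro ⟨w, rfl⟩
      exact ⟨w 0, _, ⟨_, rfl⟩, (coding_eq_contr w).symm⟩
    · rintro ⟨i, _, ⟨w, rfl⟩, rfl⟩
      let v : ℕ → Fin 3 := fun k => match k with
        | 0 => i
        | k + 1 => w k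
      have hv : coding v = contr i (coding w) := coding_eq_contr v
      exact ⟨v, hv⟩
  exact (h.subset isGasket_SG).antisymm (isGasket_SG.subset h)

theorem coding_mem_cell (n : ℕ) (ω : ℕ → Fin 3) :
    coding ω ∈ cell (List.ofFn fun k : Fin n => ω k) := by
  induction n generalizing ω with
  | zero => exact ⟨coding ω, range_coding ▸ Set.mem_range_self ω, by simp [wordMap]⟩
  | succ n ih =>
    obtain ⟨x, hx, hxe⟩ := ih fun k => ω (k + 1)
    refine ⟨x, hx, ?_⟩
    rw [List.ofFn_succ, coding_eq_contr, ← hxe]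
    rfl

/-- The law of a sequence of independent uniform letters. -/
noncomputable def bernoulli : Measure (ℕ → Fin 3) :=
  Measure.infinitePi fun _ => (PMF.uniformOfFintype (Fin 3)).toMeasure

instance : IsProbabilityMeasure bernoulli := by
  unfold bernoulli
  infer_instance

theorem bernoulli_cylinder {n : ℕ} (w : Fin n → Fin 3) :
    bernoulli {ω | (fun k : Fin n => ω k) = w} = 3⁻¹ ^ n := by
  have h : {ω : ℕ → Fin 3 | (fun k : Fin n => ω k) = w} =
      (Finset.range n : Set ℕ).pi fun k => if hk : k < n then {w ⟨k, hk⟩} else Set.univ := by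
    ext ω
    simp only [Set.mem_ofPred_eq, funext_iff, Set.mem_pi, Finset.coe_range, Set.mem_Iio]
    constructor
    · intro h k hk
      rw [dif_pos hk]
      exact h ⟨k, hk⟩
    · intro h k
      simpa using h k k.2
  rw [h, bernoulli, Measure.infinitePi_pi _ fun _ _ => MeasurableSet.of_discrete,
    Finset.prod_congr rfl (g := fun _ => (3 : ℝ≥0∞)⁻¹), Finset.prod_const, Finset.card_range]
  intro k hk
  rw [dif_pos (Finset.mem_range.1 hk), PMF.toMeasure_apply_singleton _ _ (MeasurableSet.singleton _),
    PMF.uniformOfFintype_apply]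
  simp

/-- The level-`n` cells meeting `U` are all neighbours of any one of them, so at most nine cylinders
of mass `3^(-n)` are involved. -/
theorem bernoulli_preimage_coding_le {U : Set Plane} {n : ℕ}
    (hU : ∀ x ∈ U, ∀ y ∈ U, dist x y < (1 / 2) ^ (n + 1)) :
    bernoulli (coding ⁻¹' U) ≤ 9 * 3⁻¹ ^ n := by
  classical
  set A := Finset.univ.filter fun w : Fin n → Fin 3 => ∃ x ∈ U, x ∈ cell (List.ofFn w) with hA
  have hcard : A.card ≤ 9 := by
    rcases A.eq_empty_or_nonempty with h | ⟨v, hv⟩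
    · simp [h]
    refine (Finset.card_le_card fun w hw => ?_).trans (card_near_le (List.ofFn v))
    simp only [hA, Finset.mem_filter, Finset.mem_univ, true_and] at hv hw ⊢
    obtain ⟨x, hxU, hx⟩ := hv
    obtain ⟨y, hyU, hy⟩ := hw
    exact near_of_dist_lt (by simp) hx hy (by simpa using hU x hxU y hyU)
  have hsub : coding ⁻¹' U ⊆ ⋃ w ∈ A, {ω : ℕ → Fin 3 | (fun k : Fin n => ω k) = w} := by
    intro ω hω
    refine Set.mem_biUnion (x := fun k : Fin n => ω k) ?_ rfl
    exact Finset.mem_filter.2 ⟨Finset.mem_univ _, _, hω, coding_mem_cell n ω⟩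
  calc bernoulli (coding ⁻¹' U) ≤ ∑ w ∈ A, bernoulli {ω | (fun k : Fin n => ω k) = w} :=
        (measure_mono hsub).trans (measure_biUnion_finset_le _ _)
    _ = A.card * 3⁻¹ ^ n := by simp only [bernoulli_cylinder, Finset.sum_const, nsmul_eq_mul]
    _ ≤ 9 * 3⁻¹ ^ n := by
        gcongr
        exact_mod_cast hcard

theorem exists_half_pow_le_lt {d : ℝ} (hd : 0 < d) (hd' : d < 1 / 2) :
    ∃ n : ℕ, (1 / 2) ^ (n + 2) ≤ d ∧ d < (1 / 2) ^ (n + 1) := by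
  classical
  have hex : ∃ n : ℕ, (1 / 2 : ℝ) ^ (n + 2) ≤ d := by
    obtain ⟨n, hn⟩ := exists_pow_lt_of_lt_one hd (by norm_num : (1 / 2 : ℝ) < 1)
    exact ⟨n, (pow_le_pow_of_le_one (by norm_num) (by norm_num) (by omega)).trans hn.le⟩
  refine ⟨Nat.find hex, Nat.find_spec hex, ?_⟩
  rcases h : Nat.find hex with _ | m
  · simpa using hd'
  · exact not_le.1 (Nat.find_min hex (m := m) (by omega))

theorem bernoulli_preimage_coding_le_ediam {U : Set Plane} (hU : Metric.ediam U ≤ 4⁻¹) :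
    bernoulli (coding ⁻¹' U) ≤ 81 * Metric.ediam U ^ alphaDim := by
  have htop : Metric.ediam U ≠ ∞ := ne_top_of_le_ne_top (by norm_num) hU
  have hdist : ∀ x ∈ U, ∀ y ∈ U, dist x y ≤ (Metric.ediam U).toReal := fun x hx y hy => by
    rw [dist_edist]
    exact ENNReal.toReal_mono htop (Metric.edist_le_ediam_of_mem hx hy)
  rcases eq_or_ne (Metric.ediam U) 0 with h0 | h0
  -- Diameter zero selects no scale; the bound at every level `n` shows that the mass is zero.
  · have hlim : Tendsto (fun n : ℕ => 9 * (3 : ℝ≥0∞)⁻¹ ^ n) atTop (𝓝 0) := by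
      have := ENNReal.Tendsto.const_mul (a := 9) (ENNReal.tendsto_pow_atTop_nhds_zero_of_lt_one
        (r := 3⁻¹) (by norm_num)) (Or.inr (by norm_num))
      simpa using this
    refine (ge_of_tendsto' hlim fun n => bernoulli_preimage_coding_le fun x hx y hy => ?_).trans
      zero_le
    have := hdist x hx y hy
    rw [h0, ENNReal.toReal_zero] at this
    exact this.trans_lt (by positivity)
  · have hpos : 0 < (Metric.ediam U).toReal := ENNReal.toReal_pos h0 htop
    have hlt : (Metric.ediam U).toReal < 1 / 2 := by
      refine (ENNReal.toReal_mono (by norm_num) hU).trans_lt ?_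
      norm_num
    obtain ⟨n, h1, h2⟩ := exists_half_pow_le_lt hpos hlt
    refine (bernoulli_preimage_coding_le fun x hx y hy => (hdist x hx y hy).trans_lt h2).trans ?_
    -- The lower bound on the diameter is `2^(-(n+2))`, two levels below `n`, which costs a factor
    -- `3² = 9`.
    calc (9 : ℝ≥0∞) * 3⁻¹ ^ n = 81 * 3⁻¹ ^ (n + 2) := by
          have h9 : (9 : ℝ≥0∞) * (3⁻¹ ^ 2) = 1 := by
            rw [← ENNReal.inv_pow]
            norm_num
            exact ENNReal.mul_inv_cancel (by norm_num) (by norm_num)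
          rw [pow_add, show (81 : ℝ≥0∞) = 9 * 9 by norm_num, mul_mul_mul_comm, h9, mul_one]
      _ = 81 * ENNReal.ofReal ((1 / 2) ^ (n + 2)) ^ alphaDim := by
          rw [ofReal_half_pow_rpow_alphaDim]
      _ ≤ 81 * Metric.ediam U ^ alphaDim := by
          gcongr
          · exact alphaDim_pos.le
          · rw [← ENNReal.ofReal_toReal htop]
            exact ENNReal.ofReal_le_ofReal h1

/-- Mass distribution principle: the image of the Bernoulli measure is a probability measure on the
gasket, and it gives a small set at most `81` times the `α`-th power of its diameter. -/
theorem hausdorffMeasure_SG_ne_zero : μH[alphaDim] SG ≠ 0 := by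
  have hle : (81 : ℝ≥0∞)⁻¹ • bernoulli.map coding ≤ μH[alphaDim] := by
    refine Measure.le_hausdorffMeasure _ _ 4⁻¹ (by norm_num) fun U hU => ?_
    have h1 : (bernoulli.map coding) U ≤ 81 * Metric.ediam U ^ alphaDim := by
      -- Passing to the closure gives a measurable set of the same diameter.
      refine (measure_mono (subset_closure (s := U))).trans ?_
      rw [Measure.map_apply continuous_coding.measurable isClosed_closure.measurableSet]
      rw [← Metric.ediam_closure] at hU ⊢
      exact bernoulli_preimage_coding_le_ediam hU
    rw [Measure.smul_apply, smul_eq_mul]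
    calc _ ≤ (81 : ℝ≥0∞)⁻¹ * (81 * Metric.ediam U ^ alphaDim) := by gcongr
      _ = _ := by
        rw [← mul_assoc, ENNReal.inv_mul_cancel (by norm_num) (by norm_num), one_mul]
  have h := hle SG
  rw [Measure.smul_apply, Measure.map_apply continuous_coding.measurable
    isCompact_SG.measurableSet, ← range_coding, Set.preimage_range, measure_univ] at h
  intro h0
  rw [← range_coding] at h0
  rw [h0] at h
  simp at h

/-- Pure scaling: nothing about the overlaps of cells is needed. -/
theorem nu_cell (w : List (Fin 3)) : nu (cell w) = 3⁻¹ ^ w.length := by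
  rw [nu, Measure.smul_apply, Measure.restrict_apply (measurableSet_cell w),
    Set.inter_eq_left.2 (cell_subset_SG w), hausdorffMeasure_cell, smul_eq_mul, mul_comm, mul_assoc,
    ENNReal.mul_inv_cancel hausdorffMeasure_SG_ne_zero hausdorffMeasure_SG_ne_top, mul_one]

instance : IsProbabilityMeasure nu where
  measure_univ := by
    rw [nu, Measure.smul_apply, Measure.restrict_apply_univ, smul_eq_mul,
      ENNReal.inv_mul_cancel hausdorffMeasure_SG_ne_zero hausdorffMeasure_SG_ne_top]

/-! ### The jump energy of the constant kernel -/

/-- The comparison goes through the shared vertex; `32` is `2 * 16`, from `(a - b)² ≤ 2 (a² + b²)`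
and the squared oscillation constant. -/
theorem Near.ofReal_sq_sub_le {u : Plane → ℝ} (hu : Continuous u) {v w : List (Fin 3)}
    (h : Near v w) (hl : v.length = w.length) {x y : Plane} (hx : x ∈ cell v) (hy : y ∈ cell w) :
    ENNReal.ofReal ((u x - u y) ^ 2) ≤
      32 * (energyLoc (u ∘ wordMap v) + energyLoc (u ∘ wordMap w)) := by
  obtain ⟨j, k, hjk⟩ := h.exists_vertex_eq hl
  have h1 := ofReal_sq_sub_vertex_le hu hx j
  have h2 := ofReal_sq_sub_vertex_le hu hy k
  rw [← hjk] at h2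
  set q := u (vertex v j)
  calc ENNReal.ofReal ((u x - u y) ^ 2)
      ≤ ENNReal.ofReal (2 * ((u x - q) ^ 2 + (u y - q) ^ 2)) :=
        ENNReal.ofReal_le_ofReal (by nlinarith [sq_nonneg ((u x - q) + (u y - q))])
    _ = 2 * (ENNReal.ofReal ((u x - q) ^ 2) + ENNReal.ofReal ((u y - q) ^ 2)) := by
        rw [ENNReal.ofReal_mul (by norm_num), ENNReal.ofReal_add (by positivity) (by positivity)]
        norm_num
    _ ≤ 2 * (16 * energyLoc (u ∘ wordMap v) + 16 * energyLoc (u ∘ wordMap w)) := by gcongr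
    _ = _ := by ring

theorem two_rpow_alphaDim_add (β : ℝ) : (2 : ℝ) ^ (alphaDim + β) = 3 * 2 ^ β := by
  rw [Real.rpow_add (by norm_num), two_rpow_alphaDim]

/-- The pairs of points in neighbouring cells of level `n` whose distance is at least
`2^{-(n+2)}`. -/
def nearPairs {n : ℕ} (v w : Fin n → Fin 3) : Set (Plane × Plane) :=
  {z | Near (List.ofFn v) (List.ofFn w) ∧
    z ∈ cell (List.ofFn v) ×ˢ cell (List.ofFn w) ∧ (1 / 2) ^ (n + 2) ≤ dist z.1 z.2}

theorem offDiagonal_subset_iUnion_nearPairs :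
    (SG ×ˢ SG) \ Set.diagonal Plane ⊆
      ⋃ n : ℕ, ⋃ v : Fin n → Fin 3, ⋃ w : Fin n → Fin 3, nearPairs v w := by
  rintro ⟨x, y⟩ ⟨⟨hx, hy⟩, hne⟩
  have hd : 0 < dist x y := dist_pos.2 hne
  simp only [Set.mem_iUnion]
  rcases lt_or_ge (dist x y) (1 / 2) with h | h
  · obtain ⟨n, h1, h2⟩ := exists_half_pow_le_lt hd h
    obtain ⟨v, hv⟩ := exists_mem_cell hx n
    obtain ⟨w, hw⟩ := exists_mem_cell hy n
    exact ⟨n, v, w, near_of_dist_lt (by simp) hv hw (by simpa using h2), ⟨hv, hw⟩, h1⟩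
  -- Pairs at distance at least `1/2` are put into level `0`, where both words are empty and hence
  -- near.
  · obtain ⟨v, hv⟩ := exists_mem_cell hx 0
    obtain ⟨w, hw⟩ := exists_mem_cell hy 0
    refine ⟨0, v, w, fun c => by simp [cellIndex], ⟨hv, hw⟩, ?_⟩
    norm_num
    linarith

theorem measurableSet_nearPairs {n : ℕ} (v w : Fin n → Fin 3) :
    MeasurableSet (nearPairs v w) := by
  by_cases h : Near (List.ofFn v) (List.ofFn w)
  · simp only [nearPairs, h, true_and]
    exact ((measurableSet_cell _).prod (measurableSet_cell _)).inter
      (isClosed_le continuous_const continuous_dist).measurableSet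
  · simp [nearPairs, h]

open Classical in
theorem setLIntegral_nearPairs_le {u : Plane → ℝ} (hu : Continuous u) {β : ℝ} (hβ : 0 < β)
    {n : ℕ} (v w : Fin n → Fin 3) :
    ∫⁻ z in nearPairs v w, ENNReal.ofReal
      (1 * (u z.1 - u z.2) ^ 2 / dist z.1 z.2 ^ (alphaDim + β)) ∂(nu.prod nu) ≤
    ENNReal.ofReal ((3 * 2 ^ β) ^ (n + 2)) * (3⁻¹ ^ n * 3⁻¹ ^ n) * 32 *
      if Near (List.ofFn v) (List.ofFn w) then
        energyLoc (u ∘ wordMap (List.ofFn v)) + energyLoc (u ∘ wordMap (List.ofFn w)) else 0 := by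
  by_cases h : Near (List.ofFn v) (List.ofFn w)
  swap
  · simp [nearPairs, h]
  rw [if_pos h]
  set E := energyLoc (u ∘ wordMap (List.ofFn v)) + energyLoc (u ∘ wordMap (List.ofFn w))
  have hpt : ∀ z ∈ nearPairs v w, ENNReal.ofReal
      (1 * (u z.1 - u z.2) ^ 2 / dist z.1 z.2 ^ (alphaDim + β)) ≤
      ENNReal.ofReal ((3 * 2 ^ β) ^ (n + 2)) * (32 * E) := by
    rintro ⟨x, y⟩ ⟨-, ⟨hx, hy⟩, hd⟩
    simp only at hx hy hd ⊢
    have hs : 0 < alphaDim + β := add_pos alphaDim_pos hβ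
    have hd' : (dist x y ^ (alphaDim + β))⁻¹ ≤ (3 * 2 ^ β) ^ (n + 2) := by
      rw [← two_rpow_alphaDim_add]
      refine inv_le_of_inv_le₀ (by positivity) ?_
      refine le_trans (le_of_eq ?_) (Real.rpow_le_rpow (by positivity) hd hs.le)
      rw [← Real.rpow_natCast, ← Real.rpow_natCast, ← Real.rpow_mul (by norm_num),
        ← Real.rpow_mul (by norm_num), one_div, Real.inv_rpow (by norm_num), mul_comm]
    rw [one_mul, div_eq_mul_inv, mul_comm, ENNReal.ofReal_mul (by positivity)]
    exact mul_le_mul' (ENNReal.ofReal_le_ofReal hd') (h.ofReal_sq_sub_le hu (by simp) hx hy)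
  calc _ ≤ ∫⁻ _ in nearPairs v w, ENNReal.ofReal ((3 * 2 ^ β) ^ (n + 2)) * (32 * E) ∂(nu.prod nu) :=
        setLIntegral_mono' (measurableSet_nearPairs v w) hpt
    _ = ENNReal.ofReal ((3 * 2 ^ β) ^ (n + 2)) * (32 * E) * (nu.prod nu) (nearPairs v w) := by
        rw [setLIntegral_const]
    _ ≤ ENNReal.ofReal ((3 * 2 ^ β) ^ (n + 2)) * (32 * E) *
          (nu.prod nu) (cell (List.ofFn v) ×ˢ cell (List.ofFn w)) := by
        gcongr
        exact fun z hz => hz.2.1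
    _ = _ := by
        rw [Measure.prod_prod, nu_cell, nu_cell, List.length_ofFn, List.length_ofFn]
        ring

open Classical in
theorem sum_near_energyLoc_le (u : Plane → ℝ) (n : ℕ) :
    ∑ v : Fin n → Fin 3, ∑ w : Fin n → Fin 3, (if Near (List.ofFn v) (List.ofFn w) then
        energyLoc (u ∘ wordMap (List.ofFn v)) + energyLoc (u ∘ wordMap (List.ofFn w)) else 0) ≤
      18 * (ENNReal.ofReal ((3 / 5) ^ n) * energyLoc u) := by
  have h1 : ∑ v : Fin n → Fin 3, ∑ w : Fin n → Fin 3, (if Near (List.ofFn v) (List.ofFn w) then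
        energyLoc (u ∘ wordMap (List.ofFn v)) else 0) ≤
      9 * (ENNReal.ofReal ((3 / 5) ^ n) * energyLoc u) := by
    rw [← sum_energyLoc_wordMap, Finset.mul_sum]
    refine Finset.sum_le_sum fun v _ => ?_
    rw [← Finset.sum_filter, Finset.sum_const, nsmul_eq_mul]
    gcongr
    exact_mod_cast card_near_le (List.ofFn v)
  have h2 : ∑ v : Fin n → Fin 3, ∑ w : Fin n → Fin 3, (if Near (List.ofFn v) (List.ofFn w) then
        energyLoc (u ∘ wordMap (List.ofFn w)) else 0) ≤
      9 * (ENNReal.ofReal ((3 / 5) ^ n) * energyLoc u) := by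
    rw [Finset.sum_comm]
    refine le_trans (Finset.sum_le_sum fun v _ => Finset.sum_le_sum fun w _ => ?_) h1
    exact le_of_eq (if_congr ⟨Near.symm, Near.symm⟩ rfl rfl)
  simp only [ite_add_zero, Finset.sum_add_distrib]
  refine (add_le_add h1 h2).trans_eq ?_
  rw [← add_mul]
  norm_num

/-- At scale `n` the kernel gives `(3 * 2^β)^(n+2)`, the product of cell measures `9^(-n)` and the
cell energies `(3/5)^n`, which leaves the ratio `2^β / 5`. The constant is `576 = 32 * 18`, with at
most nine neighbours for each of two cells. -/
theorem jumpEnergy_one_le_tsum {u : Plane → ℝ} (hu : Continuous u) {β : ℝ} (hβ : 0 < β) :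
    jumpEnergy (fun _ _ => 1) β u ≤
      ∑' n : ℕ, ENNReal.ofReal ((3 * 2 ^ β) ^ 2 * (2 ^ β / 5) ^ n) * (576 * energyLoc u) := by
  classical
  unfold jumpEnergy
  refine (lintegral_mono_set offDiagonal_subset_iUnion_nearPairs).trans ?_
  refine (lintegral_iUnion_le _ _).trans (ENNReal.tsum_le_tsum fun n => ?_)
  refine (lintegral_iUnion_le _ _).trans ?_
  rw [tsum_fintype]
  have h1 : ∀ v : Fin n → Fin 3, ∫⁻ z in ⋃ w : Fin n → Fin 3, nearPairs v w, ENNReal.ofReal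
      (1 * (u z.1 - u z.2) ^ 2 / dist z.1 z.2 ^ (alphaDim + β)) ∂(nu.prod nu) ≤
      ∑ w : Fin n → Fin 3, ENNReal.ofReal ((3 * 2 ^ β) ^ (n + 2)) * (3⁻¹ ^ n * 3⁻¹ ^ n) * 32 *
      if Near (List.ofFn v) (List.ofFn w) then
        energyLoc (u ∘ wordMap (List.ofFn v)) + energyLoc (u ∘ wordMap (List.ofFn w)) else 0 := by
    intro v
    refine (lintegral_iUnion_le _ _).trans ?_
    rw [tsum_fintype]
    exact Finset.sum_le_sum fun w _ => setLIntegral_nearPairs_le hu hβ v w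
  refine (Finset.sum_le_sum fun v _ => h1 v).trans ?_
  simp only [← Finset.mul_sum]
  refine (mul_le_mul_right (sum_near_energyLoc_le u n) _).trans_eq ?_
  have h3 : (3 : ℝ≥0∞)⁻¹ ^ n = ENNReal.ofReal ((1 / 3) ^ n) := by
    rw [ENNReal.ofReal_pow (by norm_num), one_div, ENNReal.ofReal_inv_of_pos (by norm_num)]
    norm_num
  have h4 : ENNReal.ofReal ((3 * 2 ^ β) ^ 2 * (2 ^ β / 5) ^ n) =
      ENNReal.ofReal ((3 * 2 ^ β) ^ (n + 2)) * (3⁻¹ ^ n * 3⁻¹ ^ n) *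
        ENNReal.ofReal ((3 / 5) ^ n) := by
    rw [h3, ← ENNReal.ofReal_mul (by positivity), ← ENNReal.ofReal_mul (by positivity),
      ← ENNReal.ofReal_mul (by positivity)]
    congr 1
    rw [pow_add, ← mul_pow, mul_comm (_ ^ n), mul_assoc, mul_assoc, ← mul_pow, ← mul_pow]
    congr 2
    ring
  rw [h4, show (576 : ℝ≥0∞) = 32 * 18 by norm_num]
  ring

/-- The prefactor equals `5 * 2^(-β) * (1 - 2^β / 5)` and cancels the sum of the geometric series.
What remains is `45 * 2^β * 576`, and `2^β < 5` makes it uniform in `β`. -/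
theorem ofReal_mul_jumpEnergy_one_le {u : Plane → ℝ} (hu : Continuous u) {β : ℝ} (hβ : 0 < β)
    (hβ' : β < walkDim) :
    ENNReal.ofReal (5 * 2 ^ (-β) - 1) * jumpEnergy (fun _ _ => 1) β u ≤
      129600 * energyLoc u := by
  have hb : (2 : ℝ) ^ β < 5 := by
    rw [← two_rpow_walkDim]
    exact Real.rpow_lt_rpow_of_exponent_lt (by norm_num) hβ'
  have hb0 : (0 : ℝ) < 2 ^ β := by positivity
  have h := jumpEnergy_one_le_tsum hu hβ
  rw [ENNReal.tsum_mul_right, ← ENNReal.ofReal_tsum_of_nonneg (fun n => by positivity)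
    ((summable_geometric_of_lt_one (by positivity) (by linarith)).mul_left _), tsum_mul_left,
    tsum_geometric_of_lt_one (by positivity) (by linarith)] at h
  have hne : (2 : ℝ) ^ β ≠ 5 := hb.ne
  have h5 : (1 : ℝ) - 2 ^ β / 5 ≠ 0 := by linarith
  have hneg : (0 : ℝ) ≤ 5 * 2 ^ (-β) - 1 := by
    rw [Real.rpow_neg (by norm_num), ← div_eq_mul_inv, sub_nonneg, le_div_iff₀ hb0]
    linarith
  calc _ ≤ ENNReal.ofReal (5 * 2 ^ (-β) - 1) *
        (ENNReal.ofReal ((3 * 2 ^ β) ^ 2 * (1 - 2 ^ β / 5)⁻¹) * (576 * energyLoc u)) := by gcongr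
    _ = ENNReal.ofReal (45 * 2 ^ β) * (576 * energyLoc u) := by
        rw [← mul_assoc, ← ENNReal.ofReal_mul hneg]
        congr 2
        rw [Real.rpow_neg (by norm_num)]
        field_simp
        ring
    _ ≤ ENNReal.ofReal 225 * (576 * energyLoc u) := by
        gcongr
        linarith
    _ = _ := by
        rw [← mul_assoc]
        norm_num

/-! ### Linearity of the jump energy in the kernel -/

theorem measurable_jump_integrand {u : Plane → ℝ} (hu : Continuous u) (s : ℝ)
    {a : Plane → Plane → ℝ} (ha : Measurable fun z : Plane × Plane => a z.1 z.2) :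
    Measurable fun z : Plane × Plane =>
      ENNReal.ofReal (a z.1 z.2 * (u z.1 - u z.2) ^ 2 / dist z.1 z.2 ^ s) := by
  have h1 : Measurable fun z : Plane × Plane => (u z.1 - u z.2) ^ 2 := by
    have : Continuous fun z : Plane × Plane => (u z.1 - u z.2) ^ 2 := by fun_prop
    exact this.measurable
  have h2 : Measurable fun z : Plane × Plane => dist z.1 z.2 ^ s :=
    continuous_dist.measurable.pow_const s
  exact ((ha.mul h1).div h2).ennreal_ofReal

theorem jumpEnergy_add {u : Plane → ℝ} (hu : Continuous u) (β : ℝ) {a b : Plane → Plane → ℝ}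
    (ha : Measurable fun z : Plane × Plane => a z.1 z.2) (ha0 : ∀ x y, 0 ≤ a x y)
    (hb0 : ∀ x y, 0 ≤ b x y) :
    jumpEnergy (fun x y => a x y + b x y) β u = jumpEnergy a β u + jumpEnergy b β u := by
  unfold jumpEnergy
  rw [← lintegral_add_left (measurable_jump_integrand hu _ ha)]
  refine lintegral_congr fun z => ?_
  rw [add_mul, add_div, ENNReal.ofReal_add]
  · have := ha0 z.1 z.2
    positivity
  · have := hb0 z.1 z.2
    positivity

theorem jumpEnergy_const_mul (u : Plane → ℝ) (β : ℝ) (a : Plane → Plane → ℝ) {c : ℝ}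
    (hc : 0 ≤ c) :
    jumpEnergy (fun x y => c * a x y) β u = ENNReal.ofReal c * jumpEnergy a β u := by
  unfold jumpEnergy
  rw [← lintegral_const_mul' _ _ ENNReal.ofReal_ne_top]
  refine lintegral_congr fun z => ?_
  rw [mul_assoc, mul_div_assoc, ENNReal.ofReal_mul hc]

theorem jumpEnergy_zero (β : ℝ) (u : Plane → ℝ) : jumpEnergy (fun _ _ => 0) β u = 0 := by
  simp [jumpEnergy]

theorem jumpEnergy_sum {u : Plane → ℝ} (hu : Continuous u) (β : ℝ) {ι : Type*} (s : Finset ι)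
    {a : ι → Plane → Plane → ℝ} (ha : ∀ t, Measurable fun z : Plane × Plane => a t z.1 z.2)
    (ha0 : ∀ t x y, 0 ≤ a t x y) :
    jumpEnergy (fun x y => ∑ t ∈ s, a t x y) β u = ∑ t ∈ s, jumpEnergy (a t) β u := by
  classical
  induction s using Finset.induction_on with
  | empty => simpa using jumpEnergy_zero β u
  | insert t s hts ih =>
    simp only [Finset.sum_insert hts]
    rw [jumpEnergy_add hu β (ha t) (ha0 t) fun x y => Finset.sum_nonneg fun t _ => ha0 t x y, ih]

theorem jumpEnergy_congr {u v : Plane → ℝ} (h : Set.EqOn u v SG) (a : Plane → Plane → ℝ) (β : ℝ) :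
    jumpEnergy a β u = jumpEnergy a β v := by
  unfold jumpEnergy
  refine setLIntegral_congr_fun ((isCompact_SG.measurableSet.prod
    isCompact_SG.measurableSet).diff isClosed_diagonal.measurableSet) fun z hz => ?_
  simp only [h hz.1.1, h hz.1.2]

/-! ### The jump energy of the kernel of a pair of cells -/

/-- The normalized indicator of `A × B`. -/
noncomputable def pairKernel (A B : Set Plane) (x y : Plane) : ℝ :=
  1 / (nu.real A * nu.real B) *
    (A.indicator (fun _ => (1 : ℝ)) x * B.indicator (fun _ => (1 : ℝ)) y)

theorem pairKernel_nonneg (A B : Set Plane) (x y : Plane) : 0 ≤ pairKernel A B x y := by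
  have h1 : 0 ≤ A.indicator (fun _ => (1 : ℝ)) x := Set.indicator_nonneg (fun _ _ => zero_le_one) x
  have h2 : 0 ≤ B.indicator (fun _ => (1 : ℝ)) y := Set.indicator_nonneg (fun _ _ => zero_le_one) y
  unfold pairKernel
  positivity

theorem pairKernel_le (A B : Set Plane) (x y : Plane) :
    pairKernel A B x y ≤ 1 / (nu.real A * nu.real B) := by
  have h1 : 0 ≤ A.indicator (fun _ => (1 : ℝ)) x := Set.indicator_nonneg (fun _ _ => zero_le_one) x
  have h2 : A.indicator (fun _ => (1 : ℝ)) x ≤ 1 := Set.indicator_le_self' (by simp) x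
  have h3 : B.indicator (fun _ => (1 : ℝ)) y ≤ 1 := Set.indicator_le_self' (by simp) y
  unfold pairKernel
  exact mul_le_of_le_one_right (by positivity) (mul_le_one₀ h2
    (Set.indicator_nonneg (fun _ _ => zero_le_one) y) h3)

theorem measurable_pairKernel {A B : Set Plane} (hA : MeasurableSet A) (hB : MeasurableSet B) :
    Measurable fun z : Plane × Plane => pairKernel A B z.1 z.2 := by
  unfold pairKernel
  have h1 : Measurable (A.indicator fun _ => (1 : ℝ)) := measurable_const.indicator hA
  have h2 : Measurable (B.indicator fun _ => (1 : ℝ)) := measurable_const.indicator hB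
  exact ((h1.comp measurable_fst).mul (h2.comp measurable_snd)).const_mul _

theorem ofReal_mul_prod_eq {A B : Set Plane} (hA : nu A ≠ 0) (hB : nu B ≠ 0) {c : ℝ}
    (hc : 0 ≤ c) :
    ENNReal.ofReal (1 / (nu.real A * nu.real B) * c) * (nu.prod nu) (A ×ˢ B) =
      ENNReal.ofReal c := by
  have h1 : nu.real A ≠ 0 := (ENNReal.toReal_pos hA (measure_ne_top _ _)).ne'
  have h2 : nu.real B ≠ 0 := (ENNReal.toReal_pos hB (measure_ne_top _ _)).ne'
  rw [Measure.prod_prod, ← ofReal_measureReal, ← ofReal_measureReal,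
    ← ENNReal.ofReal_mul measureReal_nonneg, ← ENNReal.ofReal_mul (by positivity)]
  congr 1
  field_simp

theorem jumpEnergy_pairKernel_le {A B : Set Plane} (hA : MeasurableSet A) (hB : MeasurableSet B)
    (hA0 : nu A ≠ 0) (hB0 : nu B ≠ 0) {u : Plane → ℝ} {β U : ℝ} (hU0 : 0 ≤ U)
    (hU : ∀ x ∈ A, ∀ y ∈ B, (u x - u y) ^ 2 / dist x y ^ (alphaDim + β) ≤ U) :
    jumpEnergy (pairKernel A B) β u ≤ ENNReal.ofReal U := by
  unfold jumpEnergy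
  refine (setLIntegral_le_lintegral _ _).trans ?_
  rw [← ofReal_mul_prod_eq hA0 hB0 hU0, ← lintegral_indicator_const (hA.prod hB)]
  refine lintegral_mono fun z => ?_
  by_cases hz : z ∈ A ×ˢ B
  · rw [Set.indicator_of_mem hz, mul_div_assoc]
    refine ENNReal.ofReal_le_ofReal (mul_le_mul (pairKernel_le A B _ _) (hU _ hz.1 _ hz.2)
      (by positivity) (by positivity))
  · have h0 : pairKernel A B z.1 z.2 = 0 := by
      rw [Set.mem_prod, not_and_or] at hz
      rcases hz with hz | hz <;> simp [pairKernel, Set.indicator_of_notMem hz]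
    simp [h0]

theorem le_jumpEnergy_pairKernel {A B : Set Plane} (hA : MeasurableSet A) (hB : MeasurableSet B)
    (hAS : A ⊆ SG) (hBS : B ⊆ SG) (hAB : ∀ x ∈ A, ∀ y ∈ B, x ≠ y)
    (hA0 : nu A ≠ 0) (hB0 : nu B ≠ 0) {u : Plane → ℝ} {β T : ℝ}
    (hT : ∀ x ∈ A, ∀ y ∈ B, T ≤ (u x - u y) ^ 2 / dist x y ^ (alphaDim + β)) :
    ENNReal.ofReal T ≤ jumpEnergy (pairKernel A B) β u := by
  rcases lt_or_ge T 0 with h | hT0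
  · simp [ENNReal.ofReal_of_nonpos h.le]
  have hsub : A ×ˢ B ⊆ (SG ×ˢ SG) \ Set.diagonal Plane :=
    fun z hz => ⟨⟨hAS hz.1, hBS hz.2⟩, hAB _ hz.1 _ hz.2⟩
  unfold jumpEnergy
  refine le_trans ?_ (lintegral_mono_set hsub)
  rw [← ofReal_mul_prod_eq hA0 hB0 hT0, ← setLIntegral_const]
  refine setLIntegral_mono' (hA.prod hB) fun z hz => ENNReal.ofReal_le_ofReal ?_
  rw [mul_div_assoc, pairKernel, Set.indicator_of_mem hz.1, Set.indicator_of_mem hz.2, mul_one,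
    mul_one]
  exact mul_le_mul_of_nonneg_left (hT _ hz.1 _ hz.2) (by positivity)

theorem nu_cell_ne_zero (w : List (Fin 3)) : nu (cell w) ≠ 0 := by
  rw [nu_cell]
  exact pow_ne_zero _ (by norm_num)

/-- A pair kernel has total mass one, so its jump energy is an average and inherits pointwise
bounds. The real witness `p` lets the later estimates subtract. -/
theorem exists_jumpEnergy_pairKernel_cell_eq {v w : List (Fin 3)} {u : Plane → ℝ} {β T U : ℝ}
    (hvw : ∀ x ∈ cell v, ∀ y ∈ cell w, x ≠ y)
    (hTU : ∀ x ∈ cell v, ∀ y ∈ cell w, T ≤ (u x - u y) ^ 2 / dist x y ^ (alphaDim + β) ∧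
      (u x - u y) ^ 2 / dist x y ^ (alphaDim + β) ≤ U) :
    ∃ p : ℝ, 0 ≤ p ∧ jumpEnergy (pairKernel (cell v) (cell w)) β u = ENNReal.ofReal p ∧
      T ≤ p ∧ p ≤ U := by
  have hU0 : 0 ≤ U := le_trans (by positivity)
    (hTU _ (vertex_mem_cell v 0) _ (vertex_mem_cell w 0)).2
  have h1 := jumpEnergy_pairKernel_le (measurableSet_cell v) (measurableSet_cell w)
    (nu_cell_ne_zero v) (nu_cell_ne_zero w) hU0 fun x hx y hy => (hTU x hx y hy).2
  have h2 := le_jumpEnergy_pairKernel (measurableSet_cell v) (measurableSet_cell w)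
    (cell_subset_SG v) (cell_subset_SG w) hvw
    (nu_cell_ne_zero v) (nu_cell_ne_zero w) fun x hx y hy => (hTU x hx y hy).1
  have htop := ne_top_of_le_ne_top ENNReal.ofReal_ne_top h1
  refine ⟨_, ENNReal.toReal_nonneg, (ENNReal.ofReal_toReal htop).symm, ?_, ?_⟩
  · exact (ENNReal.ofReal_le_iff_le_toReal htop).1 h2
  · exact ENNReal.toReal_le_of_le_ofReal hU0 h1

/-! ### Pairs of small cells at two vertices of a cell -/

theorem dist_vertex_vertex (w : List (Fin 3)) {j k : Fin 3} (h : j ≠ k) :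
    dist (vertex w j) (vertex w k) = (1 / 2) ^ w.length := by
  rw [vertex, vertex, dist_wordMap, dist_corner h, mul_one]

theorem abs_dist_sub_le_of_mem_cell {w : List (Fin 3)} {m : ℕ} {j k : Fin 3} (hjk : j ≠ k)
    {x y : Plane} (hx : x ∈ cell (w ++ List.replicate m j))
    (hy : y ∈ cell (w ++ List.replicate m k)) :
    |dist x y - (1 / 2) ^ w.length| ≤ (1 / 2) ^ w.length * (2 * (1 / 2) ^ m) := by
  have h1 := dist_vertex_le hx j
  have h2 := dist_vertex_le hy k
  rw [vertex_append_replicate, List.length_append, List.length_replicate, pow_add] at h1 h2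
  rw [← dist_vertex_vertex w hjk, ← Real.dist_eq]
  refine (dist_dist_dist_le x y _ _).trans ?_
  rw [dist_vertex_vertex w hjk]
  linarith

/-- With `d` the difference at the vertices and `D` the perturbation, the left side is `|D| |D +
2d|`. Only `D` sees the depth `m` of the small cells; the constant is `128 = 8 * 16`. -/
theorem abs_sq_sub_sq_le_of_mem_cell {u : Plane → ℝ} (hu : Continuous u) {S : ℝ} (hS : 0 ≤ S)
    (h : ∀ m, levelEnergy u m ≤ S ^ 2) {w : List (Fin 3)} {m : ℕ} {j k : Fin 3}
    {x y : Plane} (hx : x ∈ cell (w ++ List.replicate m j))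
    (hy : y ∈ cell (w ++ List.replicate m k)) :
    |(u x - u y) ^ 2 - (u (vertex w j) - u (vertex w k)) ^ 2| ≤
      128 * S ^ 2 * ((16 / 25) ^ w.length * (4 / 5) ^ m) := by
  have h1 := abs_sub_vertex_le hu hS h hx j
  have h2 := abs_sub_vertex_le hu hS h hy k
  have h3 := abs_sub_vertex_le hu hS h (vertex_mem_cell w j) k
  rw [vertex_append_replicate, List.length_append, List.length_replicate, pow_add] at h1 h2
  have e : (16 / 25 : ℝ) ^ w.length = (4 / 5) ^ w.length * (4 / 5) ^ w.length := by
    rw [← mul_pow]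
    norm_num
  rw [e]
  set b : ℝ := (4 / 5) ^ m with hb
  have hb0 : 0 ≤ b := by positivity
  have hb1 : b ≤ 1 := pow_le_one₀ (by norm_num) (by norm_num)
  set c : ℝ := (4 / 5) ^ w.length with hc
  have hc0 : 0 ≤ c := by positivity
  have hcS : 0 ≤ c * S := by positivity
  have hbcS : c * b * S ≤ c * S := by nlinarith
  set d := u (vertex w j) - u (vertex w k) with hd
  set D := (u x - u (vertex w j)) - (u y - u (vertex w k)) with hD
  have hDle : |D| ≤ 8 * (c * b * S) := (abs_sub _ _).trans (by linarith)
  have hDd : |D + 2 * d| ≤ 16 * (c * S) := by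
    refine (abs_add_le _ _).trans ?_
    rw [abs_mul, abs_two]
    linarith
  have hfac : (u x - u y) ^ 2 - d ^ 2 = D * (D + 2 * d) := by
    rw [hD, hd]
    ring
  rw [hfac, abs_mul]
  calc |D| * |D + 2 * d| ≤ (8 * (c * b * S)) * (16 * (c * S)) :=
        mul_le_mul hDle hDd (abs_nonneg _) (by positivity)
    _ = _ := by ring

/-- `2^(α+β*) = 15 ≤ 2^4`. This makes the distortion of the distance power uniform in `β`. -/
theorem alphaDim_add_le_four {β : ℝ} (hβ : β < walkDim) : alphaDim + β ≤ 4 := by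
  have h : (2 : ℝ) ^ (alphaDim + walkDim) ≤ 2 ^ (4 : ℝ) := by
    rw [two_rpow_alphaDim_add, two_rpow_walkDim]
    norm_num
  have := (Real.rpow_le_rpow_left_iff (by norm_num)).1 h
  linarith

theorem half_pow_rpow_alphaDim_add (n : ℕ) (β : ℝ) :
    ((1 / 2 : ℝ) ^ n) ^ (alphaDim + β) = ((3 * 2 ^ β) ^ n)⁻¹ := by
  rw [← two_rpow_alphaDim_add, ← Real.rpow_natCast, ← Real.rpow_natCast, ← Real.rpow_mul
    (by norm_num), ← Real.rpow_mul (by norm_num), one_div, Real.inv_rpow (by norm_num), mul_comm]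

theorem inv_dist_rpow_bounds {β : ℝ} (hβ : 0 < β) (hβ' : β < walkDim) {n : ℕ} {τ d : ℝ}
    (hτ : 0 ≤ τ) (hτ' : τ < 1) (hd : |d - (1 / 2) ^ n| ≤ (1 / 2) ^ n * τ) :
    1 / (1 + τ) ^ 4 * (3 * 2 ^ β) ^ n ≤ (d ^ (alphaDim + β))⁻¹ ∧
      (d ^ (alphaDim + β))⁻¹ ≤ 1 / (1 - τ) ^ 4 * (3 * 2 ^ β) ^ n := by
  have hs : 0 < alphaDim + β := add_pos alphaDim_pos hβ
  have hs4 := alphaDim_add_le_four hβ'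
  have hτ1 : 0 < 1 - τ := by linarith
  have ht : 0 < (3 * (2 : ℝ) ^ β) ^ n := by positivity
  obtain ⟨hd1, hd2⟩ := abs_le.1 hd
  have hn : (0 : ℝ) < (1 / 2) ^ n := by positivity
  have hlow : (1 / 2) ^ n * (1 - τ) ≤ d := by linarith
  have hd0 : 0 < d := lt_of_lt_of_le (by positivity) hlow
  have hup : d ≤ (1 / 2) ^ n * (1 + τ) := by linarith
  constructor
  · rw [le_inv_comm₀ (by positivity) (by positivity)]
    calc d ^ (alphaDim + β) ≤ ((1 / 2) ^ n * (1 + τ)) ^ (alphaDim + β) :=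
          Real.rpow_le_rpow hd0.le hup hs.le
      _ = ((3 * 2 ^ β) ^ n)⁻¹ * (1 + τ) ^ (alphaDim + β) := by
          rw [Real.mul_rpow (by positivity) (by positivity), half_pow_rpow_alphaDim_add]
      _ ≤ ((3 * 2 ^ β) ^ n)⁻¹ * (1 + τ) ^ (4 : ℝ) := by
          gcongr
          linarith
      _ = _ := by
          rw [show (4 : ℝ) = (4 : ℕ) by norm_num, Real.rpow_natCast]
          field_simp
  · rw [inv_le_comm₀ (by positivity) (by positivity)]
    calc (1 / (1 - τ) ^ 4 * (3 * 2 ^ β) ^ n)⁻¹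
        = ((3 * 2 ^ β) ^ n)⁻¹ * (1 - τ) ^ (4 : ℝ) := by
          rw [show (4 : ℝ) = (4 : ℕ) by norm_num, Real.rpow_natCast]
          field_simp
      _ ≤ ((3 * 2 ^ β) ^ n)⁻¹ * (1 - τ) ^ (alphaDim + β) :=
          mul_le_mul_of_nonneg_left
            (Real.rpow_le_rpow_of_exponent_ge hτ1 (by linarith) hs4) (by positivity)
      _ = ((1 / 2) ^ n * (1 - τ)) ^ (alphaDim + β) := by
          rw [Real.mul_rpow (by positivity) hτ1.le, half_pow_rpow_alphaDim_add]
      _ ≤ d ^ (alphaDim + β) := Real.rpow_le_rpow (by positivity) hlow hs.le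

theorem exists_jumpEnergy_smallCell_eq {u : Plane → ℝ} (hu : Continuous u) {S : ℝ} (hS : 0 ≤ S)
    (h : ∀ m, levelEnergy u m ≤ S ^ 2) {β : ℝ} (hβ : 0 < β) (hβ' : β < walkDim) {γ i n : ℕ}
    (hγ : 1 ≤ γ) (hi : 2 ≤ i) (hn : 1 ≤ n) (w : Fin n → Fin 3) {j k : Fin 3} (hjk : j ≠ k) :
    ∃ p : ℝ, 0 ≤ p ∧
      jumpEnergy (pairKernel (smallCell γ i w j) (smallCell γ i w k)) β u = ENNReal.ofReal p ∧
      1 / (1 + 2 * (1 / 2) ^ i) ^ 4 * (3 * 2 ^ β) ^ n *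
        ((u (vertex (List.ofFn w) j) - u (vertex (List.ofFn w) k)) ^ 2 -
          128 * S ^ 2 * ((16 / 25) ^ n * (4 / 5) ^ (γ * n * i))) ≤ p ∧
      p ≤ 1 / (1 - 2 * (1 / 2) ^ i) ^ 4 * (3 * 2 ^ β) ^ n *
        ((u (vertex (List.ofFn w) j) - u (vertex (List.ofFn w) k)) ^ 2 +
          128 * S ^ 2 * ((16 / 25) ^ n * (4 / 5) ^ (γ * n * i))) := by
  have hτ0 : (0 : ℝ) ≤ 2 * (1 / 2) ^ i := by positivity
  have hτ1 : (2 : ℝ) * (1 / 2) ^ i < 1 := by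
    have : (1 / 2 : ℝ) ^ i ≤ (1 / 2) ^ 2 := pow_le_pow_of_le_one (by norm_num) (by norm_num) hi
    linarith
  -- The relative error of the distance is thus bounded by a quantity depending on `i` alone, the
  -- same for all levels `n`.
  have him : i ≤ γ * n * i := Nat.le_mul_of_pos_left i (Nat.mul_pos hγ hn)
  have hτm : (2 : ℝ) * (1 / 2) ^ (γ * n * i) ≤ 2 * (1 / 2) ^ i :=
    mul_le_mul_of_nonneg_left (pow_le_pow_of_le_one (by norm_num) (by norm_num) him) (by norm_num)
  have hdist : ∀ x ∈ smallCell γ i w j, ∀ y ∈ smallCell γ i w k,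
      |dist x y - (1 / 2) ^ n| ≤ (1 / 2) ^ n * (2 * (1 / 2) ^ i) := fun x hx y hy => by
    have h1 := abs_dist_sub_le_of_mem_cell hjk hx hy
    rw [List.length_ofFn] at h1
    exact h1.trans (mul_le_mul_of_nonneg_left hτm (by positivity))
  refine exists_jumpEnergy_pairKernel_cell_eq (fun x hx y hy hxy => ?_) fun x hx y hy => ?_
  · have h1 := hdist x hx y hy
    rw [hxy, dist_self, zero_sub, abs_neg, abs_of_nonneg (by positivity)] at h1
    have : (0 : ℝ) < (1 / 2) ^ n := by positivity
    nlinarith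
  · obtain ⟨h1, h2⟩ := inv_dist_rpow_bounds hβ hβ' hτ0 hτ1 (hdist x hx y hy)
    have h3 := abs_sq_sub_sq_le_of_mem_cell hu hS h hx hy
    rw [List.length_ofFn] at h3
    obtain ⟨h3, h4⟩ := abs_le.1 h3
    have hlo0 : (0 : ℝ) ≤ 1 / (1 + 2 * (1 / 2) ^ i) ^ 4 * (3 * 2 ^ β) ^ n := by positivity
    rw [div_eq_mul_inv ((u x - u y) ^ 2), mul_comm ((u x - u y) ^ 2)]
    constructor
    · exact (mul_le_mul_of_nonneg_left (by linarith) hlo0).trans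
        (mul_le_mul_of_nonneg_right h1 (sq_nonneg _))
    · have hnn := hlo0.trans (h1.trans h2)
      exact (mul_le_mul_of_nonneg_right h2 (sq_nonneg _)).trans
        (mul_le_mul_of_nonneg_left (by linarith) hnn)

/-! ### The kernel `C_i` -/

theorem kernelC_eq_sum_pairKernel (γ N i : ℕ) : kernelC γ N i = fun x y =>
    ∑ n ∈ Finset.Icc 1 N, (2 : ℝ) ^ (-2 * alphaDim * (n : ℝ)) *
      ∑ w : Fin n → Fin 3, ∑ j : Fin 3, ∑ k ∈ Finset.univ.filter (fun k : Fin 3 => k ≠ j),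
        pairKernel (smallCell γ i w j) (smallCell γ i w k) x y := rfl

theorem kernelC_nonneg (γ N i : ℕ) (x y : Plane) : 0 ≤ kernelC γ N i x y := by
  rw [kernelC_eq_sum_pairKernel]
  exact Finset.sum_nonneg fun n _ => mul_nonneg (by positivity) <| Finset.sum_nonneg fun w _ =>
    Finset.sum_nonneg fun j _ => Finset.sum_nonneg fun k _ => pairKernel_nonneg _ _ _ _

theorem exists_kernelC_le (γ N i : ℕ) : ∃ M, ∀ x y, kernelC γ N i x y ≤ M := by
  refine ⟨∑ n ∈ Finset.Icc 1 N, (2 : ℝ) ^ (-2 * alphaDim * (n : ℝ)) *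
      ∑ w : Fin n → Fin 3, ∑ j : Fin 3, ∑ k ∈ Finset.univ.filter (fun k : Fin 3 => k ≠ j),
        1 / (nu.real (smallCell γ i w j) * nu.real (smallCell γ i w k)), fun x y => ?_⟩
  rw [kernelC_eq_sum_pairKernel]
  exact Finset.sum_le_sum fun n _ => mul_le_mul_of_nonneg_left (Finset.sum_le_sum fun w _ =>
    Finset.sum_le_sum fun j _ => Finset.sum_le_sum fun k _ => pairKernel_le _ _ _ _)
      (by positivity)

theorem kernelA_bounds (γ N i : ℕ) {d : ℝ} (hd0 : 0 < d) (hd1 : d < 1) :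
    ∃ c M : ℝ, 0 < c ∧ ∀ x y, c ≤ kernelA γ N i d x y ∧ kernelA γ N i d x y ≤ M := by
  obtain ⟨M, hM⟩ := exists_kernelC_le γ N i
  refine ⟨1 - d, d * M + (1 - d), by linarith, fun x y => ⟨?_, ?_⟩⟩ <;> unfold kernelA
  · linarith [mul_nonneg hd0.le (kernelC_nonneg γ N i x y)]
  · linarith [mul_le_mul_of_nonneg_left (hM x y) hd0.le]

theorem measurable_smallCell_pairKernel (γ i : ℕ) {n : ℕ} (w : Fin n → Fin 3) (j k : Fin 3) :
    Measurable fun z : Plane × Plane =>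
      pairKernel (smallCell γ i w j) (smallCell γ i w k) z.1 z.2 :=
  measurable_pairKernel (measurableSet_cell _) (measurableSet_cell _)

theorem measurable_kernelC (γ N i : ℕ) :
    Measurable fun z : Plane × Plane => kernelC γ N i z.1 z.2 := by
  rw [kernelC_eq_sum_pairKernel]
  exact Finset.measurable_fun_sum _ fun n _ => (Finset.measurable_fun_sum _ fun w _ =>
    Finset.measurable_fun_sum _ fun j _ => Finset.measurable_fun_sum _ fun k _ =>
      measurable_smallCell_pairKernel γ i w j k).const_mul _

theorem jumpEnergy_kernelC {u : Plane → ℝ} (hu : Continuous u) (β : ℝ) (γ N i : ℕ) :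
    jumpEnergy (kernelC γ N i) β u =
      ∑ n ∈ Finset.Icc 1 N, ENNReal.ofReal ((2 : ℝ) ^ (-2 * alphaDim * (n : ℝ))) *
        ∑ w : Fin n → Fin 3, ∑ j : Fin 3, ∑ k ∈ Finset.univ.filter (fun k : Fin 3 => k ≠ j),
          jumpEnergy (pairKernel (smallCell γ i w j) (smallCell γ i w k)) β u := by
  have m3 := fun (n : ℕ) (w : Fin n → Fin 3) (j k : Fin 3) =>
    measurable_smallCell_pairKernel γ i w j k
  have m2 := fun (n : ℕ) (w : Fin n → Fin 3) (j : Fin 3) =>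
    Finset.measurable_fun_sum (Finset.univ.filter fun k : Fin 3 => k ≠ j) fun k _ => m3 n w j k
  have m1 := fun (n : ℕ) (w : Fin n → Fin 3) =>
    Finset.measurable_fun_sum Finset.univ fun (j : Fin 3) _ => m2 n w j
  have m0 := fun (n : ℕ) =>
    Finset.measurable_fun_sum Finset.univ fun (w : Fin n → Fin 3) _ => m1 n w
  have p3 := fun (n : ℕ) (w : Fin n → Fin 3) (j k : Fin 3) =>
    pairKernel_nonneg (smallCell γ i w j) (smallCell γ i w k)
  have p2 := fun (n : ℕ) (w : Fin n → Fin 3) (j : Fin 3) (x y : Plane) =>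
    Finset.sum_nonneg fun k (_ : k ∈ Finset.univ.filter fun k : Fin 3 => k ≠ j) => p3 n w j k x y
  have p1 := fun (n : ℕ) (w : Fin n → Fin 3) (x y : Plane) =>
    Finset.sum_nonneg fun j (_ : j ∈ (Finset.univ : Finset (Fin 3))) => p2 n w j x y
  have p0 := fun (n : ℕ) (x y : Plane) =>
    Finset.sum_nonneg fun w (_ : w ∈ (Finset.univ : Finset (Fin n → Fin 3))) => p1 n w x y
  rw [kernelC_eq_sum_pairKernel, jumpEnergy_sum hu β _ (fun n => (m0 n).const_mul _)
    fun n x y => mul_nonneg (by positivity) (p0 n x y)]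
  refine Finset.sum_congr rfl fun n _ => ?_
  rw [jumpEnergy_const_mul _ _ _ (by positivity), jumpEnergy_sum hu β _ (m1 n) (p1 n)]
  congr 1
  refine Finset.sum_congr rfl fun w _ => ?_
  rw [jumpEnergy_sum hu β _ (m2 n w) (p2 n w)]
  refine Finset.sum_congr rfl fun j _ => ?_
  rw [jumpEnergy_sum hu β _ (m3 n w j) (p3 n w j)]

theorem jumpEnergy_kernelA {u : Plane → ℝ} (hu : Continuous u) (β : ℝ) (γ N i : ℕ) {d : ℝ}
    (hd0 : 0 ≤ d) (hd1 : d ≤ 1) :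
    jumpEnergy (kernelA γ N i d) β u = ENNReal.ofReal d * jumpEnergy (kernelC γ N i) β u +
      ENNReal.ofReal (1 - d) * jumpEnergy (fun _ _ => 1) β u := by
  rw [← jumpEnergy_const_mul _ _ _ hd0, ← jumpEnergy_const_mul _ _ _ (sub_nonneg.2 hd1),
    ← jumpEnergy_add hu β ((measurable_kernelC γ N i).const_mul d)
      (fun x y => mul_nonneg hd0 (kernelC_nonneg γ N i x y))
      fun x y => mul_nonneg (sub_nonneg.2 hd1) zero_le_one]
  simp only [mul_one]
  rfl

theorem sum_sq_sub_vertex (u : Plane → ℝ) (n : ℕ) :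
    ∑ w : Fin n → Fin 3, ∑ j : Fin 3, ∑ k ∈ Finset.univ.filter (fun k : Fin 3 => k ≠ j),
      (u (vertex (List.ofFn w) j) - u (vertex (List.ofFn w) k)) ^ 2 =
      (3 / 5) ^ n * levelEnergy u n := by
  rw [levelEnergy, ← mul_assoc, ← mul_pow]
  norm_num
  refine Finset.sum_congr rfl fun w _ => Finset.sum_congr rfl fun j _ => ?_
  refine Finset.sum_filter_of_ne fun k _ hk hkj => hk ?_
  simp [hkj]

theorem sum_const_words (n : ℕ) (c : ℝ) :
    ∑ _w : Fin n → Fin 3, ∑ j : Fin 3, ∑ _k ∈ Finset.univ.filter (fun k : Fin 3 => k ≠ j), c =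
      6 * 3 ^ n * c := by
  have h : ∀ j : Fin 3, (Finset.univ.filter fun k : Fin 3 => k ≠ j).card = 2 := by decide
  simp only [Finset.sum_const, h, Finset.card_univ, Fintype.card_fun, Fintype.card_fin,
    nsmul_eq_mul]
  push_cast
  ring

theorem two_rpow_neg_two_alphaDim (n : ℕ) :
    (2 : ℝ) ^ (-2 * alphaDim * (n : ℝ)) = (1 / 9) ^ n := by
  rw [Real.rpow_mul (by norm_num), Real.rpow_natCast, mul_comm, Real.rpow_mul (by norm_num),
    two_rpow_alphaDim, Real.rpow_neg (by norm_num)]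
  norm_num

/-- The distance distortion appears as factors tending to one with `i`; the oscillation error
appears as an additive constant independent of `i`, `β` and the cutoff `N`. -/
theorem exists_jumpEnergy_kernelC_eq {u : Plane → ℝ} (hu : Continuous u) {S : ℝ} (hS : 0 ≤ S)
    (h : ∀ m, levelEnergy u m ≤ S ^ 2) {β : ℝ} (hβ : 0 < β) (hβ' : β < walkDim) {γ i : ℕ}
    (hγ : 1 ≤ γ) (hi : 6 ≤ i) (N : ℕ) :
    ∃ X : ℝ, 0 ≤ X ∧ jumpEnergy (kernelC γ N i) β u = ENNReal.ofReal X ∧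
      1 / (1 + 2 * (1 / 2) ^ i) ^ 4 *
        (∑ n ∈ Finset.Icc 1 N, (2 ^ β / 5) ^ n * levelEnergy u n - 7680 * S ^ 2) ≤ X ∧
      X ≤ 1 / (1 - 2 * (1 / 2) ^ i) ^ 4 *
        (∑ n ∈ Finset.Icc 1 N, (2 ^ β / 5) ^ n * levelEnergy u n + 7680 * S ^ 2) := by
  -- `choose!` makes `p` total; its values off `1 ≤ n ∧ j ≠ k` are arbitrary and never enter the
  -- sums.
  have key : ∀ (n : ℕ) (w : Fin n → Fin 3) (j k : Fin 3), 1 ≤ n ∧ j ≠ k → _ :=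
    fun n w j k hh => exists_jumpEnergy_smallCell_eq hu hS h hβ hβ' hγ
      (le_trans (by norm_num) hi) hh.1 w hh.2
  choose! p hp0 hpe hpl hpu using key
  set lo : ℝ := 1 / (1 + 2 * (1 / 2) ^ i) ^ 4 with hlo
  set hi' : ℝ := 1 / (1 - 2 * (1 / 2) ^ i) ^ 4 with hhi
  have hlo0 : 0 ≤ lo := by positivity
  have hhi0 : 0 ≤ hi' := by
    rw [hhi]
    exact div_nonneg zero_le_one (Even.pow_nonneg (by decide) _)
  set err : ℕ → ℝ := fun n => 128 * S ^ 2 * ((16 / 25) ^ n * (4 / 5) ^ (γ * n * i)) with herr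
  set Q : ℕ → ℝ := fun n => ∑ w : Fin n → Fin 3, ∑ j : Fin 3,
    ∑ k ∈ Finset.univ.filter (fun k : Fin 3 => k ≠ j), p n w j k with hQ
  have hne : ∀ {j k : Fin 3}, k ∈ Finset.univ.filter (fun k : Fin 3 => k ≠ j) → j ≠ k :=
    fun hk => (Finset.mem_filter.1 hk).2.symm
  have hQ0 : ∀ n, 1 ≤ n → 0 ≤ Q n := fun n hn => Finset.sum_nonneg fun w _ =>
    Finset.sum_nonneg fun j _ => Finset.sum_nonneg fun k hk => hp0 n w j k ⟨hn, hne hk⟩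
  have hterm : ∀ n, (1 / 9 : ℝ) ^ n * ((3 * 2 ^ β) ^ n * ((3 / 5) ^ n * levelEnergy u n)) =
      (2 ^ β / 5) ^ n * levelEnergy u n := fun n => by
    rw [← mul_assoc, ← mul_assoc, ← mul_pow, ← mul_pow]
    congr 2
    ring
  have hb : (2 : ℝ) ^ β < 5 := by
    rw [← two_rpow_walkDim]
    exact Real.rpow_lt_rpow_of_exponent_lt (by norm_num) hβ'
  have herr_le : ∀ n, (1 / 9 : ℝ) ^ n * ((3 * 2 ^ β) ^ n * (6 * 3 ^ n * err n)) ≤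
      768 * S ^ 2 * (9 / 10) ^ n := fun n => by
    -- Without this gain the error would grow with ratio up to `5 * 16/25 > 1`. Six factors `4/5`
    -- bring the ratio below `9/10`, whence `6 ≤ i` and the sum `768 * 10 = 7680`.
    have h1 : (4 / 5 : ℝ) ^ (γ * n * i) ≤ ((4 / 5) ^ 6) ^ n := by
      rw [← pow_mul]
      refine pow_le_pow_of_le_one (by norm_num) (by norm_num) ?_
      calc 6 * n = 1 * n * 6 := by ring
        _ ≤ γ * n * i := by gcongr
    have h2 : (1 / 9 : ℝ) ^ n * ((3 * 2 ^ β) ^ n * (6 * 3 ^ n * err n)) =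
        768 * S ^ 2 * ((2 ^ β * (16 / 25)) ^ n * (4 / 5) ^ (γ * n * i)) := by
      have e : (2 ^ β * (16 / 25) : ℝ) ^ n = (1 / 9) ^ n * (3 * 2 ^ β) ^ n * 3 ^ n * (16 / 25) ^ n := by
        rw [← mul_pow, ← mul_pow, ← mul_pow]
        congr 1
        ring
      rw [herr, e]
      ring
    rw [h2]
    refine mul_le_mul_of_nonneg_left ?_ (by positivity)
    calc (2 ^ β * (16 / 25) : ℝ) ^ n * (4 / 5) ^ (γ * n * i)
        ≤ (5 * (16 / 25)) ^ n * ((4 / 5) ^ 6) ^ n := by gcongr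
      _ = (5 * (16 / 25) * (4 / 5) ^ 6) ^ n := by rw [← mul_pow]
      _ ≤ (9 / 10) ^ n := by
          gcongr
          norm_num
  have herr_sum : ∑ n ∈ Finset.Icc 1 N, (1 / 9 : ℝ) ^ n * ((3 * 2 ^ β) ^ n * (6 * 3 ^ n * err n)) ≤
      7680 * S ^ 2 := by
    have hg := (summable_geometric_of_lt_one (r := (9 / 10 : ℝ)) (by norm_num)
      (by norm_num)).sum_le_tsum (Finset.Icc 1 N) fun n _ => by positivity
    rw [tsum_geometric_of_lt_one (by norm_num) (by norm_num)] at hg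
    refine (Finset.sum_le_sum fun n _ => herr_le n).trans ?_
    rw [← Finset.mul_sum]
    nlinarith [mul_le_mul_of_nonneg_left hg (sq_nonneg S)]
  refine ⟨∑ n ∈ Finset.Icc 1 N, (1 / 9) ^ n * Q n, Finset.sum_nonneg fun n hn =>
    mul_nonneg (by positivity) (hQ0 n (Finset.mem_Icc.1 hn).1), ?_, ?_, ?_⟩
  · rw [jumpEnergy_kernelC hu, ENNReal.ofReal_sum_of_nonneg fun n hn =>
      mul_nonneg (by positivity) (hQ0 n (Finset.mem_Icc.1 hn).1)]
    refine Finset.sum_congr rfl fun n hn => ?_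
    have hn1 := (Finset.mem_Icc.1 hn).1
    rw [two_rpow_neg_two_alphaDim, ENNReal.ofReal_mul (by positivity), hQ]
    congr 1
    rw [ENNReal.ofReal_sum_of_nonneg fun w _ => Finset.sum_nonneg fun j _ =>
      Finset.sum_nonneg fun k hk => hp0 n w j k ⟨hn1, hne hk⟩]
    refine Finset.sum_congr rfl fun w _ => ?_
    rw [ENNReal.ofReal_sum_of_nonneg fun j _ =>
      Finset.sum_nonneg fun k hk => hp0 n w j k ⟨hn1, hne hk⟩]
    refine Finset.sum_congr rfl fun j _ => ?_
    rw [ENNReal.ofReal_sum_of_nonneg fun k hk => hp0 n w j k ⟨hn1, hne hk⟩]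
    exact Finset.sum_congr rfl fun k hk => hpe n w j k ⟨hn1, hne hk⟩
  · calc lo * (∑ n ∈ Finset.Icc 1 N, (2 ^ β / 5) ^ n * levelEnergy u n - 7680 * S ^ 2)
        ≤ lo * (∑ n ∈ Finset.Icc 1 N, (2 ^ β / 5) ^ n * levelEnergy u n -
          ∑ n ∈ Finset.Icc 1 N, (1 / 9 : ℝ) ^ n * ((3 * 2 ^ β) ^ n * (6 * 3 ^ n * err n))) :=
        mul_le_mul_of_nonneg_left (by linarith) hlo0
      _ = ∑ n ∈ Finset.Icc 1 N, (1 / 9) ^ n * (lo * (3 * 2 ^ β) ^ n *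
          ((3 / 5) ^ n * levelEnergy u n - 6 * 3 ^ n * err n)) := by
        rw [← Finset.sum_sub_distrib, Finset.mul_sum]
        refine Finset.sum_congr rfl fun n _ => ?_
        rw [← hterm]
        ring
      _ ≤ _ := by
        refine Finset.sum_le_sum fun n hn => mul_le_mul_of_nonneg_left ?_ (by positivity)
        rw [← sum_sq_sub_vertex, ← sum_const_words n (err n)]
        simp only [← Finset.sum_sub_distrib, Finset.mul_sum]
        exact Finset.sum_le_sum fun w _ => Finset.sum_le_sum fun j _ => Finset.sum_le_sum
          fun k hk => hpl n w j k ⟨(Finset.mem_Icc.1 hn).1, hne hk⟩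
  · calc ∑ n ∈ Finset.Icc 1 N, (1 / 9) ^ n * Q n
        ≤ ∑ n ∈ Finset.Icc 1 N, (1 / 9) ^ n * (hi' * (3 * 2 ^ β) ^ n *
          ((3 / 5) ^ n * levelEnergy u n + 6 * 3 ^ n * err n)) := by
            refine Finset.sum_le_sum fun n hn => mul_le_mul_of_nonneg_left ?_ (by positivity)
            rw [← sum_sq_sub_vertex, ← sum_const_words n (err n)]
            simp only [← Finset.sum_add_distrib, Finset.mul_sum]
            exact Finset.sum_le_sum fun w _ => Finset.sum_le_sum fun j _ => Finset.sum_le_sum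
              fun k hk => hpu n w j k ⟨(Finset.mem_Icc.1 hn).1, hne hk⟩
      _ = hi' * (∑ n ∈ Finset.Icc 1 N, (2 ^ β / 5) ^ n * levelEnergy u n +
          ∑ n ∈ Finset.Icc 1 N, (1 / 9 : ℝ) ^ n * ((3 * 2 ^ β) ^ n * (6 * 3 ^ n * err n))) := by
        rw [← Finset.sum_add_distrib, Finset.mul_sum]
        refine Finset.sum_congr rfl fun n _ => ?_
        rw [← hterm]
        ring
      _ ≤ _ := mul_le_mul_of_nonneg_left (by linarith) hhi0

/-! ### Abel summation -/

theorem mul_sum_inv_pow (ε : ℝ) (hε : 0 < ε) (N : ℕ) :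
    ε * ∑ n ∈ Finset.Icc 1 N, (1 + ε)⁻¹ ^ n = 1 - (1 + ε)⁻¹ ^ N := by
  induction N with
  | zero => simp
  | succ N ih =>
    have h : (1 + ε) * (1 + ε)⁻¹ = 1 := mul_inv_cancel₀ (by positivity)
    rw [Finset.sum_Icc_succ_top (by omega), mul_add, ih, pow_succ]
    linear_combination (1 + ε)⁻¹ ^ N * h

/-- The upper bound is `e n ≤ E`. For the lower bound, fix `M` with `e M` close to `E`: replacing
every `e n` by `e M` overestimates only for `n < M`, at a cost of at most `ε i * (M * e M) → 0`. -/
theorem tendsto_mul_sum_inv_pow_mul {e : ℕ → ℝ} (he : Monotone e) (he0 : ∀ n, 0 ≤ e n) {E : ℝ}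
    (hE : Tendsto e atTop (𝓝 E)) {ε : ℕ → ℝ} (hε : ∀ i, 1 ≤ i → 0 < ε i)
    (hε0 : Tendsto ε atTop (𝓝 0)) {Φ : ℕ → ℕ} (hΦ : ∀ i : ℕ, 1 ≤ i → (i : ℝ) ≤ ε i * Φ i) :
    Tendsto (fun i => ε i * ∑ n ∈ Finset.Icc 1 (Φ i), (1 + ε i)⁻¹ ^ n * e n) atTop (𝓝 E) := by
  have hle : ∀ n, e n ≤ E := fun n => he.ge_of_tendsto hE n
  refine tendsto_order.2 ⟨fun a ha => ?_, fun b hb => ?_⟩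
  · obtain ⟨M, hM⟩ := ((tendsto_order.1 hE).1 a ha).exists
    have hlim : Tendsto (fun i : ℕ => (1 - 1 / ((i : ℝ) + 1)) * e M - ε i * (M * e M)) atTop
        (𝓝 ((1 - 0) * e M - 0 * (M * e M))) :=
      ((tendsto_const_nhds.sub tendsto_one_div_add_atTop_nhds_zero_nat).mul_const _).sub
        (hε0.mul_const _)
    rw [sub_zero, one_mul, zero_mul, sub_zero] at hlim
    filter_upwards [(tendsto_order.1 hlim).1 a hM, eventually_ge_atTop 1] with i hi hi1
    have hεi := hε i hi1
    have hr0 : 0 < (1 + ε i)⁻¹ := by positivity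
    have hr1 : (1 + ε i)⁻¹ ≤ 1 := inv_le_one_of_one_le₀ (by linarith)
    refine hi.trans_le ?_
    have h1 : ∑ n ∈ Finset.Icc 1 (Φ i), (1 + ε i)⁻¹ ^ n * e M - M * e M ≤
        ∑ n ∈ Finset.Icc 1 (Φ i), (1 + ε i)⁻¹ ^ n * e n := by
      have h2 : ∑ n ∈ Finset.Icc 1 (Φ i), (if n < M then e M else 0) ≤ M * e M := by
        rw [← Finset.sum_filter, Finset.sum_const, nsmul_eq_mul]
        refine mul_le_mul_of_nonneg_right ?_ (he0 M)
        rw [Nat.cast_le]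
        refine (Finset.card_le_card fun n hn => ?_).trans_eq (Finset.card_range M)
        exact Finset.mem_range.2 (Finset.mem_filter.1 hn).2
      have h3 : ∑ n ∈ Finset.Icc 1 (Φ i), (1 + ε i)⁻¹ ^ n * e M ≤
          ∑ n ∈ Finset.Icc 1 (Φ i), ((1 + ε i)⁻¹ ^ n * e n + if n < M then e M else 0) := by
        refine Finset.sum_le_sum fun n _ => ?_
        have hrn : (0 : ℝ) < (1 + ε i)⁻¹ ^ n := by positivity
        have hrn1 : (1 + ε i)⁻¹ ^ n ≤ 1 := pow_le_one₀ hr0.le hr1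
        split_ifs with hn
        · nlinarith [he0 n, he0 M, mul_nonneg hrn.le (he0 n)]
        · rw [add_zero]
          exact mul_le_mul_of_nonneg_left (he (not_lt.1 hn)) hrn.le
      rw [Finset.sum_add_distrib] at h3
      linarith
    have h4 : (1 + ε i)⁻¹ ^ Φ i ≤ 1 / ((i : ℝ) + 1) := by
      rw [inv_pow, ← one_div]
      refine one_div_le_one_div_of_le (by positivity) ?_
      -- Bernoulli's inequality turns `i ≤ ε i * Φ i` into `i + 1 ≤ (1 + ε i)^Φ i`.
      have := one_add_mul_le_pow (a := ε i) (by linarith) (Φ i)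
      linarith [hΦ i hi1]
    calc (1 - 1 / ((i : ℝ) + 1)) * e M - ε i * (M * e M)
        ≤ (1 - (1 + ε i)⁻¹ ^ Φ i) * e M - ε i * (M * e M) := by
          linarith [mul_le_mul_of_nonneg_right h4 (he0 M)]
      _ = ε i * (∑ n ∈ Finset.Icc 1 (Φ i), (1 + ε i)⁻¹ ^ n * e M - M * e M) := by
          rw [← mul_sum_inv_pow _ hεi, ← Finset.sum_mul]
          ring
      _ ≤ _ := mul_le_mul_of_nonneg_left h1 hεi.le
  · filter_upwards [eventually_ge_atTop 1] with i hi1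
    have hεi := hε i hi1
    refine lt_of_le_of_lt ?_ hb
    calc ε i * ∑ n ∈ Finset.Icc 1 (Φ i), (1 + ε i)⁻¹ ^ n * e n
        ≤ ε i * ∑ n ∈ Finset.Icc 1 (Φ i), (1 + ε i)⁻¹ ^ n * E := by
          gcongr with n
          exact hle n
      _ = (1 - (1 + ε i)⁻¹ ^ Φ i) * E := by
          rw [← Finset.sum_mul, ← mul_assoc, mul_sum_inv_pow _ hεi]
      _ ≤ E := by
          have : 0 ≤ (1 + ε i)⁻¹ ^ Φ i := by positivity
          nlinarith [(he0 0).trans (hle 0)]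

theorem exists_strictMono_le_mul {ε : ℕ → ℝ} (hε : ∀ i, 1 ≤ i → 0 < ε i) :
    ∃ Φ : ℕ → ℕ, StrictMono Φ ∧ ∀ i : ℕ, 1 ≤ i → (i : ℝ) ≤ ε i * Φ i := by
  -- The last summand alone gives the inequality; summation and the `+ 1` give strict growth.
  refine ⟨fun i => ∑ k ∈ Finset.range (i + 1), (⌈(k : ℝ) / ε k⌉₊ + 1),
    strictMono_nat_of_lt_succ fun i => ?_, fun i hi => ?_⟩
  · rw [Finset.sum_range_succ _ (i + 1)]
    omega
  · rw [mul_comm, ← div_le_iff₀ (hε i hi)]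
    refine (Nat.le_ceil _).trans ?_
    rw [Nat.cast_le]
    beta_reduce
    rw [Finset.sum_range_succ]
    omega

/-! ### Convergence of the energies -/

/-- Tietze extension. Both energies depend only on values on the gasket, so global continuity, and
with it measurability of the integrands, may be assumed. -/
theorem exists_continuous_eqOn_SG {u : Plane → ℝ} (hu : ContinuousOn u SG) :
    ∃ v : Plane → ℝ, Continuous v ∧ Set.EqOn u v SG := by
  obtain ⟨g, hg⟩ := ContinuousMap.exists_restrict_eq isCompact_SG.isClosed
    ⟨SG.domRestrict u, hu.domRestrict⟩
  exact ⟨g, g.continuous, fun x hx => (DFunLike.congr_fun hg ⟨x, hx⟩).symm⟩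

theorem tendsto_mul_jumpEnergy_kernelC {u : Plane → ℝ} (hu : Continuous u) (hE : energyLoc u ≠ ∞)
    {γ : ℕ} (hγ : 1 ≤ γ) {β : ℕ → ℝ} (hβ : ∀ i : ℕ, 1 ≤ i → 0 < β i ∧ β i < walkDim)
    (hβ_lim : Tendsto β atTop (𝓝 walkDim)) {Φ : ℕ → ℕ}
    (hΦ : ∀ i : ℕ, 1 ≤ i → (i : ℝ) ≤ (5 * (2 : ℝ) ^ (-β i) - 1) * (Φ i : ℝ)) :
    Tendsto (fun i => ENNReal.ofReal (5 * (2 : ℝ) ^ (-β i) - 1) *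
      jumpEnergy (kernelC γ (Φ i) i) (β i) u) atTop (𝓝 (energyLoc u)) := by
  set E := (energyLoc u).toReal with hEdef
  have hE0 : 0 ≤ E := ENNReal.toReal_nonneg
  have hEe : ENNReal.ofReal E = energyLoc u := ENNReal.ofReal_toReal hE
  have hle : ∀ m, levelEnergy u m ≤ Real.sqrt E ^ 2 := fun m => by
    rw [Real.sq_sqrt hE0]
    exact levelEnergy_le_toReal hE m
  have hlimE : Tendsto (levelEnergy u) atTop (𝓝 E) :=
    ((ENNReal.tendsto_toReal hE).comp (tendsto_levelEnergy u)).congr fun n =>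
      ENNReal.toReal_ofReal (levelEnergy_nonneg u n)
  set ε : ℕ → ℝ := fun i => 5 * (2 : ℝ) ^ (-β i) - 1 with hεdef
  have hεpos : ∀ i, 1 ≤ i → 0 < ε i := fun i hi => by
    have h1 : (2 : ℝ) ^ (-walkDim) < 2 ^ (-β i) :=
      Real.rpow_lt_rpow_of_exponent_lt (by norm_num) (neg_lt_neg (hβ i hi).2)
    rw [Real.rpow_neg (by norm_num), two_rpow_walkDim] at h1
    simp only [hεdef]
    linarith
  have hε0 : Tendsto ε atTop (𝓝 0) := by
    have h1 : Tendsto (fun i => (2 : ℝ) ^ (-β i)) atTop (𝓝 (2 ^ (-walkDim))) :=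
      tendsto_const_nhds.rpow hβ_lim.neg (Or.inl (by norm_num))
    rw [Real.rpow_neg (by norm_num), two_rpow_walkDim] at h1
    have h2 := (h1.const_mul 5).sub_const 1
    norm_num at h2
    exact h2
  -- This identifies the ratio of the level weights with the one in the summation lemma.
  have hr : ∀ i, (1 + ε i)⁻¹ = 2 ^ β i / 5 := fun i => by
    simp only [hεdef]
    rw [Real.rpow_neg (by norm_num), add_sub_cancel]
    field_simp
  have hsum := tendsto_mul_sum_inv_pow_mul (monotone_levelEnergy u) (levelEnergy_nonneg u) hlimE
    hεpos hε0 hΦ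
  set X : ℕ → ℝ := fun i => (jumpEnergy (kernelC γ (Φ i) i) (β i) u).toReal with hX
  have hXspec : ∀ i, 6 ≤ i → jumpEnergy (kernelC γ (Φ i) i) (β i) u = ENNReal.ofReal (X i) ∧
      1 / (1 + 2 * (1 / 2) ^ i) ^ 4 * (∑ n ∈ Finset.Icc 1 (Φ i), (1 + ε i)⁻¹ ^ n * levelEnergy u n -
        7680 * Real.sqrt E ^ 2) ≤ X i ∧
      X i ≤ 1 / (1 - 2 * (1 / 2) ^ i) ^ 4 *
        (∑ n ∈ Finset.Icc 1 (Φ i), (1 + ε i)⁻¹ ^ n * levelEnergy u n +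
        7680 * Real.sqrt E ^ 2) := fun i hi => by
    have hi1 : 1 ≤ i := by omega
    obtain ⟨Y, hY0, hYe, hYl, hYu⟩ := exists_jumpEnergy_kernelC_eq hu (Real.sqrt_nonneg E) hle
      (hβ i hi1).1 (hβ i hi1).2 hγ hi (Φ i)
    have hXY : X i = Y := by
      simp only [hX]
      rw [hYe, ENNReal.toReal_ofReal hY0]
    rw [hXY, hr]
    exact ⟨hYe, hYl, hYu⟩
  have hτ : Tendsto (fun i : ℕ => (2 : ℝ) * (1 / 2) ^ i) atTop (𝓝 0) := by
    simpa using (tendsto_pow_atTop_nhds_zero_of_lt_one (r := (1 / 2 : ℝ))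
      (by norm_num) (by norm_num)).const_mul 2
  have hlo : Tendsto (fun i : ℕ => 1 / (1 + (2 : ℝ) * (1 / 2) ^ i) ^ 4) atTop (𝓝 1) := by
    simpa using ((hτ.const_add 1).pow 4).inv₀ (by norm_num)
  have hhi : Tendsto (fun i : ℕ => 1 / (1 - (2 : ℝ) * (1 / 2) ^ i) ^ 4) atTop (𝓝 1) := by
    simpa using ((hτ.const_sub 1).pow 4).inv₀ (by norm_num)
  have herr : Tendsto (fun i => ε i * (7680 * Real.sqrt E ^ 2)) atTop (𝓝 0) := by
    simpa using hε0.mul_const (7680 * Real.sqrt E ^ 2)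
  have hXlim : Tendsto (fun i => ε i * X i) atTop (𝓝 E) := by
    have hl := hlo.mul (hsum.sub herr)
    have hu := hhi.mul (hsum.add herr)
    rw [one_mul, sub_zero] at hl
    rw [one_mul, add_zero] at hu
    refine tendsto_of_tendsto_of_tendsto_of_le_of_le' hl hu ?_ ?_
    · filter_upwards [eventually_ge_atTop 6] with i hi
      rw [← mul_sub, mul_left_comm]
      exact mul_le_mul_of_nonneg_left (hXspec i hi).2.1 (hεpos i (by omega)).le
    · filter_upwards [eventually_ge_atTop 6] with i hi
      rw [← mul_add, mul_left_comm]
      exact mul_le_mul_of_nonneg_left (hXspec i hi).2.2 (hεpos i (by omega)).le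
  rw [← hEe]
  refine (ENNReal.tendsto_ofReal hXlim).congr' ?_
  filter_upwards [eventually_ge_atTop 6] with i hi
  rw [(hXspec i hi).1, ENNReal.ofReal_mul (hεpos i (by omega)).le]

theorem tendsto_mul_jumpEnergy_kernelA {u : Plane → ℝ} (hu : Continuous u) (hE : energyLoc u ≠ ∞)
    {γ : ℕ} (hγ : 1 ≤ γ) {β : ℕ → ℝ} (hβ : ∀ i : ℕ, 1 ≤ i → 0 < β i ∧ β i < walkDim)
    (hβ_lim : Tendsto β atTop (𝓝 walkDim)) {δ : ℕ → ℝ}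
    (hδ : ∀ i : ℕ, 1 ≤ i → 0 < δ i ∧ δ i < 1) (hδ_lim : Tendsto δ atTop (𝓝 1)) {Φ : ℕ → ℕ}
    (hΦ : ∀ i : ℕ, 1 ≤ i → (i : ℝ) ≤ (5 * (2 : ℝ) ^ (-β i) - 1) * (Φ i : ℝ)) :
    Tendsto (fun i => ENNReal.ofReal (5 * (2 : ℝ) ^ (-β i) - 1) *
      jumpEnergy (kernelA γ (Φ i) i (δ i)) (β i) u) atTop (𝓝 (energyLoc u)) := by
  have h1 := ENNReal.Tendsto.mul (ENNReal.tendsto_ofReal hδ_lim) (Or.inr hE)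
    (tendsto_mul_jumpEnergy_kernelC hu hE hγ hβ hβ_lim hΦ) (Or.inr ENNReal.ofReal_ne_top)
  have h2 : Tendsto (fun i => ENNReal.ofReal (1 - δ i) *
      (ENNReal.ofReal (5 * (2 : ℝ) ^ (-β i) - 1) * jumpEnergy (fun _ _ => 1) (β i) u))
      atTop (𝓝 0) := by
    have h3 : Tendsto (fun i => ENNReal.ofReal (1 - δ i) * (129600 * energyLoc u)) atTop
        (𝓝 (ENNReal.ofReal (1 - 1) * (129600 * energyLoc u))) :=
      ENNReal.Tendsto.mul_const (ENNReal.tendsto_ofReal (hδ_lim.const_sub 1))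
        (Or.inr (ENNReal.mul_ne_top (by norm_num) hE))
    rw [sub_self, ENNReal.ofReal_zero, zero_mul] at h3
    refine tendsto_of_tendsto_of_tendsto_of_le_of_le' tendsto_const_nhds h3
      (Eventually.of_forall fun _ => zero_le) ?_
    filter_upwards [eventually_ge_atTop 1] with i hi
    exact mul_le_mul_right (ofReal_mul_jumpEnergy_one_le hu (hβ i hi).1 (hβ i hi).2) _
  have h4 := h1.add h2
  rw [ENNReal.ofReal_one, one_mul, add_zero] at h4
  refine h4.congr' ?_
  filter_upwards [eventually_ge_atTop 1] with i hi
  rw [jumpEnergy_kernelA hu _ _ _ _ (hδ i hi).1.le (hδ i hi).2.le]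
  ring

end Gasket

theorem mainTheorem4 (γ : ℕ) (hγ : 1 ≤ γ)
    (β : ℕ → ℝ) (hβ : ∀ i : ℕ, 1 ≤ i → alphaDim < β i ∧ β i < walkDim)
    (hβ_mono : MonotoneOn β (Set.Ici 1)) (hβ_lim : Tendsto β atTop (𝓝 walkDim))
    (δ : ℕ → ℝ) (hδ : ∀ i : ℕ, 1 ≤ i → 0 < δ i ∧ δ i < 1)
    (hδ_mono : MonotoneOn δ (Set.Ici 1)) (hδ_lim : Tendsto δ atTop (𝓝 1)) :
    (∃ Φ : ℕ → ℕ, StrictMono Φ ∧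
      ∀ i : ℕ, 1 ≤ i → (i : ℝ) ≤ (5 * (2 : ℝ) ^ (-β i) - 1) * (Φ i : ℝ)) ∧
    ∀ Φ : ℕ → ℕ, MonotoneOn Φ (Set.Ici 1) →
      (∀ i : ℕ, 1 ≤ i → (i : ℝ) ≤ (5 * (2 : ℝ) ^ (-β i) - 1) * (Φ i : ℝ)) →
      (∀ i : ℕ, 1 ≤ i → ∃ c M : ℝ, 0 < c ∧ ∀ x ∈ SG, ∀ y ∈ SG,
        c ≤ kernelA γ (Φ i) i (δ i) x y ∧ kernelA γ (Φ i) i (δ i) x y ≤ M) ∧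
      ∀ u ∈ domLoc,
        Tendsto (fun i : ℕ => ENNReal.ofReal (5 * (2 : ℝ) ^ (-β i) - 1) *
            jumpEnergy (kernelA γ (Φ i) i (δ i)) (β i) u)
          atTop (𝓝 (energyLoc u)) := by

  refine ⟨exists_strictMono_le_mul fun i hi => ?_, fun Φ _ hΦ => ⟨fun i hi => ?_, ?_⟩⟩
  · have h1 : (2 : ℝ) ^ (-walkDim) < 2 ^ (-β i) :=
      Real.rpow_lt_rpow_of_exponent_lt (by norm_num) (neg_lt_neg (hβ i hi).2)
    rw [Real.rpow_neg (by norm_num), two_rpow_walkDim] at h1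
    linarith
  · obtain ⟨c, M, hc, h⟩ := kernelA_bounds γ (Φ i) i (hδ i hi).1 (hδ i hi).2
    exact ⟨c, M, hc, fun x _ y _ => h x y⟩
  · rintro u ⟨hu, hE⟩
    obtain ⟨v, hv, huv⟩ := exists_continuous_eqOn_SG hu
    simp only [jumpEnergy_congr huv]
    rw [energyLoc_congr huv] at hE ⊢
    exact tendsto_mul_jumpEnergy_kernelA hv hE.ne hγ
      (fun i hi => ⟨alphaDim_pos.trans (hβ i hi).1, (hβ i hi).2⟩) hβ_lim hδ hδ_lim hΦ
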